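/- A digraph $D$ consists of a non-empty vertex set $VD$ and an irreflexive, antisymmetric edge relation (no loops, no pair of opposite edges); $xy$ denotes an edge directed from $x$ to $y$, and $x,y$ are then adjacent. Put $N^+(x)=\{y: xy\in ED\}$ and $N^-(x)=\{y: yx\in ED\}$. $D$ is locally finite if $N^+(x)\cup N^-(x)$ is finite for every $x$, and connected if its underlying undirected graph is. $D$ is C-homogeneous if every isomorphism between two finite connected induced subdigraphs of $D$ extends to an automorphism of $D$. The ends of $D$ are the ends of its underlying undirected graph $G$, that is, the classes of rays (one-way infinite paths) of $G$, where two rays are equivalent if for every finite vertex set $S$ both lie eventually in the same component of $G-S$. An alternating walk is a sequence $x_0x_1\dots x_n$ of vertices in which $x_i,x_{i+1}$ are adjacent for $0\le i<n$ and $x_{i-1}\in N^+(x_i)\Leftrightarrow x_{i+1}\in N^+(x_i)$ for $1\le i\le n-1$. The reachability digraph of an edge $e$ is the subdigraph whose edges are all edges that lie with $e$ on a common alternating walk, and whose vertices are the end vertices of these edges. It is a bipartite reachability digraph if it is bipartite with a bipartition one class of which has empty in-neighbourhoods and the other empty out-neighbourhoods in it. If $D$ is C-homogeneous and has an edge, all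 reachability digraphs of $D$ are isomorphic, and $\Delta(D)$ denotes this common digraph. $C_m$ is the directed cycle of length $m$, $\bar K_n$ is the digraph with $n$ vertices and no edges, and $D[D']$ is the lexicographic product, with vertex set $VD\times VD'$ and an edge from $(x,y)$ to $(x',y')$ if and only if $xx'\in ED$, or $x=x'$ and $yy'\in ED'$. **Lemma 4.6.** Let $D$ be a locally finite connected C-homogeneous digraph with at least one edge that contains no directed triangle and such that, for every vertex $x$, no two vertices of $N^+(x)$ are adjacent and no two vertices of $N^-(x)$ are adjacent. If $\Delta(D)$ is a bipartite reachability digraph, then $D$ has at least two ends or $D\cong C_m[\bar K_n]$ for some integers $m\ge 4$ and $n\ge 1$. -/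

import Mathlib

namespace Digraph

/-- The out-neighbourhood of `x`. -/
def outNbhd {V : Type*} (D : Digraph V) (x : V) : Set V := {y | D.Adj x y}

/-- The in-neighbourhood of `x`. -/
def inNbhd {V : Type*} (D : Digraph V) (x : V) : Set V := {y | D.Adj y x}

/-- The edge relation is asymmetric: no loops and no pair of opposite edges. -/
def IsAsymmetric {V : Type*} (D : Digraph V) : Prop :=
  ∀ x y, D.Adj x y → ¬ D.Adj y x

/-- Every vertex has finite degree. -/
def IsLocallyFinite {V : Type*} (D : Digraph V) : Prop :=
  ∀ x, (D.outNbhd x ∪ D.inNbhd x).Finite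

/-- A digraph is connected if its underlying undirected graph is. -/
def IsConnected {V : Type*} (D : Digraph V) : Prop :=
  D.toSimpleGraphInclusive.Connected

/-- A vertex set is independent if no two of its vertices are adjacent. -/
def IsIndependent {V : Type*} (D : Digraph V) (s : Set V) : Prop :=
  ∀ x ∈ s, ∀ y ∈ s, ¬ D.Adj x y

/-- There is a directed triangle `x → y → z → x`. -/
def HasDirectedTriangle {V : Type*} (D : Digraph V) : Prop :=
  ∃ x y z, D.Adj x y ∧ D.Adj y z ∧ D.Adj z x

/-- The subdigraph induced by a vertex set. -/
def inducedOn {V : Type*} (D : Digraph V) (s : Set V) : Digraph s where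
  Adj x y := D.Adj x y

/-- Isomorphisms of digraphs. -/
abbrev DiIso {V W : Type*} (D : Digraph V) (E : Digraph W) := D.Adj ≃r E.Adj

/-- `D` is connected-homogeneous: every isomorphism between two finite connected induced
subdigraphs extends to an automorphism of `D`. -/
def IsCHomogeneous {V : Type*} (D : Digraph V) : Prop :=
  ∀ A B : Set V, A.Finite → B.Finite →
    (D.inducedOn A).IsConnected → (D.inducedOn B).IsConnected →
    ∀ φ : DiIso (D.inducedOn A) (D.inducedOn B),
      ∃ α : DiIso D D, ∀ a : A, α (a : V) = (φ a : V)

/-! ### The reachability relation -/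

/-- `x 0, x 1, …, x n` is an alternating walk: consecutive vertices are adjacent, and at each
inner vertex `x (i + 1)` both edges of the walk point away from it or both point towards it. -/
def IsAlternatingWalk {V : Type*} (D : Digraph V) (n : ℕ) (x : ℕ → V) : Prop :=
  (∀ i, i < n → D.Adj (x i) (x (i + 1)) ∨ D.Adj (x (i + 1)) (x i)) ∧
  (∀ i, i + 1 < n → (D.Adj (x (i + 1)) (x i) ↔ D.Adj (x (i + 1)) (x (i + 2))))

/-- The pair `e` is traversed, in one of the two directions, by the walk `x 0, …, x n`. -/
def LiesOnWalk {V : Type*} (e : V × V) (n : ℕ) (x : ℕ → V) : Prop :=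
  ∃ i, i < n ∧ ((x i = e.1 ∧ x (i + 1) = e.2) ∨ (x i = e.2 ∧ x (i + 1) = e.1))

/-- The edges `e` and `f` (pairs whose first entry is the tail) lie on a common
alternating walk. -/
def Reachable {V : Type*} (D : Digraph V) (e f : V × V) : Prop :=
  D.Adj e.1 e.2 ∧ D.Adj f.1 f.2 ∧
    ∃ (n : ℕ) (x : ℕ → V), D.IsAlternatingWalk n x ∧ LiesOnWalk e n x ∧ LiesOnWalk f n x

/-- The vertices incident with an edge that is reachable from `e`. -/
def reachabilityVerts {V : Type*} (D : Digraph V) (e : V × V) : Set V :=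
  {v | ∃ f, D.Reachable e f ∧ (v = f.1 ∨ v = f.2)}

/-- The reachability digraph of `e`: its edges are the edges reachable from `e`, and its vertices
are their end vertices. -/
def reachabilityDigraph {V : Type*} (D : Digraph V) (e : V × V) :
    Digraph (D.reachabilityVerts e) where
  Adj x y := D.Reachable e (x, y)

/-- `G` is bipartite with classes `X` and `Y` such that no vertex of `X` has a predecessor and no
vertex of `Y` has a successor. -/
def IsBipartiteSourceSink {W : Type*} (G : Digraph W) : Prop :=
  ∃ X Y : Set W, IsCompl X Y ∧ G.IsIndependent X ∧ G.IsIndependent Y ∧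
    (∀ x ∈ X, G.inNbhd x = ∅) ∧ (∀ y ∈ Y, G.outNbhd y = ∅)

/-- `D` has an edge, and the reachability digraph of each edge is a bipartite reachability
digraph. (If `D` is 1-arc transitive, these digraphs are all isomorphic.) -/
def HasBipartiteReachability {V : Type*} (D : Digraph V) : Prop :=
  (∃ e : V × V, D.Adj e.1 e.2) ∧
    ∀ e : V × V, D.Adj e.1 e.2 → (D.reachabilityDigraph e).IsBipartiteSourceSink

/-! ### Ends -/

/-- A ray of an undirected graph: a one-way infinite path. -/
structure Ray {V : Type*} (G : SimpleGraph V) where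
  /-- The vertices of the ray, in order. -/
  vert : ℕ → V
  injective : Function.Injective vert
  adj : ∀ n, G.Adj (vert n) (vert (n + 1))

/-- Two rays are equivalent if for every finite vertex set `S` both lie eventually in the same
component of `G - S`. -/
def Ray.Equivalent {V : Type*} {G : SimpleGraph V} (R R' : Ray G) : Prop :=
  ∀ S : Set V, S.Finite → ∃ C : G.ComponentCompl S,
    (∃ N, ∀ n, N ≤ n → R.vert n ∈ C) ∧ (∃ N, ∀ n, N ≤ n → R'.vert n ∈ C)

theorem Ray.Equivalent.refl {V : Type*} {G : SimpleGraph V} (R : Ray G) : R.Equivalent R := by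
  intro S hS
  have hfin : {n | R.vert n ∈ S}.Finite := hS.preimage R.injective.injOn
  obtain ⟨M, hM⟩ := hfin.bddAbove
  have hout : ∀ n, M + 1 ≤ n → R.vert n ∉ S := by
    intro n hn h
    have := hM h
    omega
  have key : ∀ n, M + 1 ≤ n →
      R.vert n ∈ G.componentComplMk (hout (M + 1) le_rfl) := by
    intro n hn
    induction n, hn using Nat.le_induction with
    | base => exact G.componentComplMk_mem _
    | succ k hk ih =>
      exact SimpleGraph.ComponentCompl.mem_of_adj _ _ ih (hout (k + 1) (by omega)) (R.adj k)
  exact ⟨_, ⟨M + 1, key⟩, ⟨M + 1, key⟩⟩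

theorem Ray.Equivalent.symm {V : Type*} {G : SimpleGraph V} {R R' : Ray G}
    (h : R.Equivalent R') : R'.Equivalent R := by
  intro S hS
  obtain ⟨C, h1, h2⟩ := h S hS
  exact ⟨C, h2, h1⟩

theorem Ray.Equivalent.trans {V : Type*} {G : SimpleGraph V} {R R' R'' : Ray G}
    (h : R.Equivalent R') (h' : R'.Equivalent R'') : R.Equivalent R'' := by
  intro S hS
  obtain ⟨C, h1, N, h2⟩ := h S hS
  obtain ⟨C', ⟨N', h3⟩, h4⟩ := h' S hS
  have hCC : C = C' := by
    obtain ⟨_, e⟩ := h2 (max N N') (le_max_left _ _)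
    obtain ⟨_, e'⟩ := h3 (max N N') (le_max_right _ _)
    exact e.symm.trans e'
  subst hCC
  exact ⟨C, h1, h4⟩

/-- Equivalence of rays. -/
def raySetoid {V : Type*} (G : SimpleGraph V) : Setoid (Ray G) where
  r R R' := R.Equivalent R'
  iseqv := ⟨Ray.Equivalent.refl, Ray.Equivalent.symm, Ray.Equivalent.trans⟩

/-- The ends of a digraph: the equivalence classes of rays of the underlying undirected graph. -/
def Ends {V : Type*} (D : Digraph V) : Type _ := Quotient (raySetoid D.toSimpleGraphInclusive)

/-! ### The digraphs `C_m` and lexicographic products -/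

/-- The directed cycle of length `m`, for `m ≥ 3`. -/
def directedCycle (m : ℕ) : Digraph (ZMod m) where
  Adj i j := j = i + 1

/-- The lexicographic product `D[E]`. -/
def lexProduct {V W : Type*} (D : Digraph V) (E : Digraph W) : Digraph (V × W) where
  Adj p q := D.Adj p.1 q.1 ∨ (p.1 = q.1 ∧ E.Adj p.2 q.2)

end Digraph

/-! Group the edges into classes under alternating reachability. Bipartiteness of Δ(D) says exactly
that at each vertex x the class `oc x` of its out-edges differs from the class `ic x` of its
in-edges. The underlying graph is triangle-free, so any two neighbours of a common vertex are
non-adjacent. Hence C-homogeneity gives the swap principle used throughout: two vertices with the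
same adjacencies to a finite connected set F, and at least one neighbour in F, are exchanged by an
automorphism fixing F pointwise.

Layered case. Suppose two out-neighbours of some vertex have the same out-class (or dually). A
shortest walk inside a class between two distinct neighbours of a vertex p, where p is joined to the
start by an edge outside the class, combines with a counting argument for the symmetric group
(`forall_of_ncard_lt`) to force every class to be complete bipartite. Then vertices with a common
in-neighbour have the same out-neighbours, and dually. A directed cycle makes such a digraph
C_m[K̄_n]; otherwise an out-neighbourhood separates a forward ray from a backward one. In- or
out-degree one is treated in the same way.

Splitting case. Otherwise out-neighbours of a vertex have distinct out-classes and in-neighbours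
distinct in-classes (`Splits`). For a, a' → x delete the finitely many vertices that distinguish a
from a', and consider the component of x, its side. An automorphism swapping a and a' can fix any
prescribed finite part of the side, and rigidity (`Splits.eq_of_fixes`) makes the complement of the
side infinite. If some side is infinite, there are two ends. If all sides are finite, then classes
are finite, and so is what hangs off a class at each of its vertices; so D is finite, a
contradiction. -/

open Digraph

/-! ### Finite connected sets -/

/-- The sets that arise from a single vertex by successively adding neighbours: the finite
connected vertex sets. -/
inductive FinConn {V : Type*} (adj : V → V → Prop) : Set V → Prop
  | single (v : V) : FinConn adj {v}
  | cons {F : Set V} {u v : V} : FinConn adj F → u ∈ F → adj u v → FinConn adj (insert v F)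

namespace FinConn

variable {V : Type*} {adj : V → V → Prop} {F : Set V}

theorem finite (h : FinConn adj F) : F.Finite := by
  induction h with
  | single v => exact Set.finite_singleton v
  | cons _ _ _ ih => exact ih.insert _

theorem nonempty (h : FinConn adj F) : F.Nonempty := by
  cases h with
  | single v => exact Set.singleton_nonempty v
  | cons _ _ _ => exact Set.insert_nonempty _ _

theorem union (h : FinConn adj F) {P : Set V} (hP : P.Finite)
    (hadj : ∀ p ∈ P, ∃ u ∈ F, adj u p) : FinConn adj (F ∪ P) := by
  induction P, hP using Set.Finite.induction_on with
  | empty => simpa using h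
  | @insert a P _ _ ih =>
    rw [Set.union_insert]
    obtain ⟨u, hu, hua⟩ := hadj a (Set.mem_insert _ _)
    exact (ih fun p hp => hadj p (Set.mem_insert_of_mem _ hp)).cons (Or.inl hu) hua

/-- A vertex reachable inside `T` can be added together with a connecting path. -/
theorem extend {T : Set V} (h : FinConn adj F) (hFT : F ⊆ T) {x y : V} (hx : x ∈ F)
    (hxy : Relation.ReflTransGen (fun u v => adj u v ∧ v ∈ T) x y) :
    ∃ K, FinConn adj K ∧ F ⊆ K ∧ K ⊆ T ∧ y ∈ K := by
  induction hxy with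
  | refl => exact ⟨F, h, subset_rfl, hFT, hx⟩
  | tail _ hbc ih =>
    obtain ⟨K, hK, hFK, hKT, hb⟩ := ih
    exact ⟨insert _ K, hK.cons hb hbc.1, hFK.trans (Set.subset_insert _ _),
      Set.insert_subset hbc.2 hKT, Set.mem_insert _ _⟩

theorem extend_finite {T : Set V} (h : FinConn adj F) (hFT : F ⊆ T) {x : V} (hx : x ∈ F)
    {P : Set V} (hP : P.Finite)
    (hxP : ∀ y ∈ P, Relation.ReflTransGen (fun u v => adj u v ∧ v ∈ T) x y) :
    ∃ K, FinConn adj K ∧ F ⊆ K ∧ K ⊆ T ∧ P ⊆ K := by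
  induction P, hP using Set.Finite.induction_on with
  | empty => exact ⟨F, h, subset_rfl, hFT, Set.empty_subset _⟩
  | @insert a P _ _ ih =>
    obtain ⟨K, hK, hFK, hKT, hPK⟩ := ih fun y hy => hxP y (Set.mem_insert_of_mem _ hy)
    obtain ⟨K', hK', hKK', hKT', haK'⟩ := hK.extend hKT (hFK hx) (hxP a (Set.mem_insert _ _))
    exact ⟨K', hK', hFK.trans hKK', hKT', Set.insert_subset haK' (hPK.trans hKK')⟩

theorem image_chain (c : ℕ → V) (n : ℕ) (hc : ∀ i < n, adj (c i) (c (i + 1))) :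
    FinConn adj {v | ∃ i ≤ n, c i = v} := by
  induction n with
  | zero =>
    have : {v | ∃ i ≤ 0, c i = v} = {c 0} := by
      ext v
      simp [eq_comm]
    rw [this]
    exact .single _
  | succ n ih =>
    have : {v | ∃ i ≤ n + 1, c i = v} = insert (c (n + 1)) {v | ∃ i ≤ n, c i = v} := by
      ext v
      simp only [Set.mem_insert_iff, Set.mem_ofPred_eq]
      constructor
      · rintro ⟨i, hi, rfl⟩
        rcases Nat.lt_or_ge i (n + 1) with h | h
        · exact Or.inr ⟨i, by omega, rfl⟩
        · exact Or.inl (by rw [show i = n + 1 by omega])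
      · rintro (rfl | ⟨i, hi, rfl⟩)
        · exact ⟨_, le_rfl, rfl⟩
        · exact ⟨i, by omega, rfl⟩
    rw [this]
    exact (ih fun i hi => hc i (by omega)).cons ⟨n, le_rfl, rfl⟩ (hc n (by omega))

end FinConn

/-- The underlying undirected graph of a loopless relation. -/
def relGraph {V : Type*} (r : V → V → Prop) (h : ∀ x, ¬ r x x) : SimpleGraph V where
  Adj u v := r u v ∨ r v u
  symm := ⟨fun _ _ h => h.symm⟩
  loopless := ⟨fun x hx => hx.elim (h x) (h x)⟩

/-! ### Digraphs with reachability classes and their automorphisms -/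

/-- A vertex-transitive triangle-free digraph in which independent vertices of the same type over
a finite connected set can be swapped, together with the classes of its edges under
reachability by alternating walks. Every edge out of `x` lies in the class `oc x` and every edge
into `x` lies in the class `ic x`. -/
structure ClassedDigraph (V : Type u) where
  /-- The edge relation. -/
  r : V → V → Prop
  /-- The type of reachability classes. -/
  C : Type u
  /-- The class of the edges into a vertex. -/
  ic : V → C
  /-- The class of the edges out of a vertex. -/
  oc : V → C
  asymm : ∀ x y, r x y → ¬ r y x
  tri : ∀ x y z, (r x y ∨ r y x) → (r y z ∨ r z y) → ¬ (r x z ∨ r z x)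
  finOut : ∀ x, {y | r x y}.Finite
  finIn : ∀ x, {y | r y x}.Finite
  neOut : ∀ x, ∃ y, r x y
  neIn : ∀ x, ∃ y, r y x
  conn : (relGraph r fun x hx => asymm x x hx hx).Connected
  edge : ∀ x y, r x y → oc x = ic y
  ne : ∀ x, ic x ≠ oc x
  clmap : ∀ α : Equiv.Perm V, (∀ x y, r (α x) (α y) ↔ r x y) →
    ∃ f : C → C, (∀ x, oc (α x) = f (oc x)) ∧ ∀ x, ic (α x) = f (ic x)
  -- Alternation of the walk need not be demanded: by `ne`, a vertex cannot have both its in-edges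
  -- and its out-edges in B.
  chain : ∀ B u v, (ic u = B ∨ oc u = B) → (ic v = B ∨ oc v = B) →
    Relation.ReflTransGen (fun a b => (r a b ∧ oc a = B) ∨ (r b a ∧ oc b = B)) u v
  vt : ∀ x y, ∃ α : Equiv.Perm V, (∀ x y, r (α x) (α y) ↔ r x y) ∧ α x = y
  sw : ∀ F : Set V, FinConn (fun u v => r u v ∨ r v u) F → ∀ v w, v ∉ F → w ∉ F →
    (∀ u ∈ F, (r u v ↔ r u w) ∧ (r v u ↔ r w u)) → (∃ u ∈ F, r u v ∨ r v u) →
    ∃ α : Equiv.Perm V, (∀ x y, r (α x) (α y) ↔ r x y) ∧ (∀ u ∈ F, α u = u) ∧ α v = w ∧ α w = v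

namespace ClassedDigraph

variable {V : Type u} (S : ClassedDigraph V)

/-- Adjacency in the underlying undirected graph. -/
def adj (u v : V) : Prop := S.r u v ∨ S.r v u

/-- The underlying undirected graph. -/
def graph : SimpleGraph V := relGraph S.r fun x hx => S.asymm x x hx hx

/-- Automorphisms. -/
def Aut (α : Equiv.Perm V) : Prop := ∀ x y, S.r (α x) (α y) ↔ S.r x y

/-- Adjacency through an edge of the class `B`. -/
def e (B : S.C) (u v : V) : Prop := (S.r u v ∧ S.oc u = B) ∨ (S.r v u ∧ S.oc v = B)

/-- Two vertices have the same type over a set. -/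
def SameType (F : Set V) (v w : V) : Prop := ∀ u ∈ F, (S.r u v ↔ S.r u w) ∧ (S.r v u ↔ S.r w u)

/-- The reversed digraph. -/
def rev : ClassedDigraph V where
  r x y := S.r y x
  C := S.C
  ic := S.oc
  oc := S.ic
  asymm x y h := S.asymm y x h
  tri x y z h1 h2 h3 := S.tri x y z h1.symm h2.symm h3.symm
  finOut := S.finIn
  finIn := S.finOut
  neOut := S.neIn
  neIn := S.neOut
  conn := by
    have : relGraph (fun x y => S.r y x) (fun x hx => S.asymm x x hx hx) = S.graph := by
      ext u v
      exact or_comm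
    rw [this]
    exact S.conn
  edge x y h := (S.edge y x h).symm
  ne x := (S.ne x).symm
  clmap α h := by
    obtain ⟨f, h1, h2⟩ := S.clmap α fun x y => h y x
    exact ⟨f, h2, h1⟩
  chain B u v hu hv := by
    refine Relation.ReflTransGen.mono (fun a b hab => ?_) _ _ (S.chain B u v hu.symm hv.symm)
    rcases hab with ⟨h, rfl⟩ | ⟨h, rfl⟩
    · exact Or.inr ⟨h, (S.edge _ _ h).symm⟩
    · exact Or.inl ⟨h, (S.edge _ _ h).symm⟩
  vt x y := by
    obtain ⟨α, h1, h2⟩ := S.vt x y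
    exact ⟨α, fun x y => h1 y x, h2⟩
  sw F hF v w hv hw ht hadj := by
    have : (fun u v => S.r v u ∨ S.r u v) = fun u v => S.r u v ∨ S.r v u := by
      ext u v
      exact or_comm
    rw [this] at hF
    obtain ⟨α, h1, h2⟩ := S.sw F hF v w hv hw (fun u hu => (ht u hu).symm)
      (by obtain ⟨u, hu, h⟩ := hadj; exact ⟨u, hu, h.symm⟩)
    exact ⟨α, fun x y => h1 y x, h2⟩

theorem rev_adj : S.rev.adj = S.adj := by
  ext u v
  exact or_comm

theorem rev_graph : S.rev.graph = S.graph := by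
  ext u v
  exact or_comm

variable {S}

theorem rev_aut {α : Equiv.Perm V} (h : S.rev.Aut α) : S.Aut α := fun x y => h y x

theorem rev_e {B : S.C} {u v : V} : S.rev.e B u v ↔ S.e B u v := by
  constructor
  · rintro (⟨h, rfl⟩ | ⟨h, rfl⟩)
    · exact Or.inr ⟨h, S.edge _ _ h⟩
    · exact Or.inl ⟨h, S.edge _ _ h⟩
  · rintro (⟨h, rfl⟩ | ⟨h, rfl⟩)
    · exact Or.inr ⟨h, (S.edge _ _ h).symm⟩
    · exact Or.inl ⟨h, (S.edge _ _ h).symm⟩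

theorem adj_symm {u v : V} (h : S.adj u v) : S.adj v u := Or.symm h

theorem irrefl (x : V) : ¬ S.r x x := fun h => S.asymm x x h h

theorem ne_of_r {x y : V} (h : S.r x y) : x ≠ y := by
  rintro rfl
  exact irrefl x h

theorem not_adj_of_common {x y z : V} (h1 : S.adj x y) (h2 : S.adj y z) : ¬ S.adj x z :=
  S.tri x y z h1 h2

theorem e_symm {B : S.C} {u v : V} (h : S.e B u v) : S.e B v u := Or.symm h

theorem e_adj {B : S.C} {u v : V} (h : S.e B u v) : S.adj u v := h.imp And.left And.left

theorem finite_adj (u : V) : {v | S.adj u v}.Finite := (S.finOut u).union (S.finIn u)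

theorem connected_adj (u v : V) : Relation.ReflTransGen S.adj u v := by
  have h := S.conn.preconnected u v
  rw [SimpleGraph.reachable_iff_reflTransGen] at h
  exact h

theorem Aut.oc_eq {α : Equiv.Perm V} (h : S.Aut α) {x y : V} (hxy : S.oc x = S.oc y) :
    S.oc (α x) = S.oc (α y) := by
  obtain ⟨f, h1, _⟩ := S.clmap α h
  rw [h1, h1, hxy]

theorem Aut.oc_ic_eq {α : Equiv.Perm V} (h : S.Aut α) {x y : V} (hxy : S.oc x = S.ic y) :
    S.oc (α x) = S.ic (α y) := by
  obtain ⟨f, h1, h2⟩ := S.clmap α h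
  rw [h1, h2, hxy]

theorem Aut.ic_eq {α : Equiv.Perm V} (h : S.Aut α) {x y : V} (hxy : S.ic x = S.ic y) :
    S.ic (α x) = S.ic (α y) := by
  obtain ⟨f, _, h2⟩ := S.clmap α h
  rw [h2, h2, hxy]

theorem exists_swap {F : Set V} (hF : FinConn S.adj F) {v w : V} (hv : v ∉ F) (hw : w ∉ F)
    (ht : S.SameType F v w) {u : V} (hu : u ∈ F) (huv : S.adj u v) :
    ∃ α, S.Aut α ∧ (∀ u ∈ F, α u = u) ∧ α v = w ∧ α w = v :=
  S.sw F hF v w hv hw ht ⟨u, hu, huv⟩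

/-- Arc transitivity. -/
theorem exists_aut_arc {u v x y : V} (huv : S.r u v) (hxy : S.r x y) :
    ∃ α, S.Aut α ∧ α u = x ∧ α v = y := by
  obtain ⟨α, hα, rfl⟩ := S.vt u x
  have h1 : S.r (α u) (α v) := (hα u v).2 huv
  obtain ⟨β, hβ, hβF, hβv, _⟩ := exists_swap (S := S) (F := {α u}) (.single _) (v := α v) (w := y)
    (by simpa using (ne_of_r h1).symm) (by simpa using (ne_of_r hxy).symm)
    (by
      rintro z rfl
      exact ⟨iff_of_true h1 hxy, iff_of_false (S.asymm _ _ h1) (S.asymm _ _ hxy)⟩)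
    (u := α u) rfl (Or.inl h1)
  refine ⟨α.trans β, fun a b => ?_, hβF _ rfl, hβv⟩
  rw [Equiv.trans_apply, Equiv.trans_apply, hβ, hα]

/-- Transitivity on pairs of out-neighbours. -/
theorem exists_aut_out_pair {a y y' b z z' : V} (h1 : S.r a y) (h2 : S.r a y') (hne : y ≠ y')
    (h3 : S.r b z) (h4 : S.r b z') (hne' : z ≠ z') :
    ∃ α, S.Aut α ∧ α a = b ∧ α y = z ∧ α y' = z' := by
  obtain ⟨α, hα, rfl, rfl⟩ := exists_aut_arc h1 h3
  have h5 : S.r (α a) (α y') := (hα _ _).2 h2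
  have hF : FinConn S.adj {α y, α a} := (FinConn.single (α a)).cons rfl (Or.inl h3)
  have n1 : ¬ S.adj (α y) (α y') := not_adj_of_common (Or.inr h3) (Or.inl h5)
  have n2 : ¬ S.adj (α y) z' := not_adj_of_common (Or.inr h3) (Or.inl h4)
  obtain ⟨β, hβ, hβF, hβv, _⟩ := exists_swap hF (v := α y') (w := z')
    (by
      rintro (h | h)
      · exact hne (α.injective h.symm)
      · exact ne_of_r h5 h.symm)
    (by
      rintro (h | h)
      · exact hne' h.symm
      · exact ne_of_r h4 h.symm)
    (by
      rintro w (rfl | rfl)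
      · exact ⟨iff_of_false (fun h => n1 (Or.inl h)) fun h => n2 (Or.inl h),
          iff_of_false (fun h => n1 (Or.inr h)) fun h => n2 (Or.inr h)⟩
      · exact ⟨iff_of_true h5 h4, iff_of_false (S.asymm _ _ h5) (S.asymm _ _ h4)⟩)
    (u := α a) (Or.inr rfl) (Or.inl h5)
  refine ⟨α.trans β, fun u v => ?_, hβF _ (Or.inr rfl), hβF _ (Or.inl rfl), hβv⟩
  rw [Equiv.trans_apply, Equiv.trans_apply, hβ, hα]

/-- Transitivity on directed paths with three vertices. -/
theorem exists_aut_two_arc {u p w u' p' w' : V} (h1 : S.r u p) (h2 : S.r p w)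
    (h3 : S.r u' p') (h4 : S.r p' w') :
    ∃ α, S.Aut α ∧ α u = u' ∧ α p = p' ∧ α w = w' := by
  obtain ⟨α, hα, rfl, rfl⟩ := exists_aut_arc h1 h3
  have h5 : S.r (α p) (α w) := (hα _ _).2 h2
  have hF : FinConn S.adj {α p, α u} := (FinConn.single (α u)).cons rfl (Or.inl h3)
  have n1 : ¬ S.adj (α u) (α w) := not_adj_of_common (Or.inl h3) (Or.inl h5)
  have n2 : ¬ S.adj (α u) w' := not_adj_of_common (Or.inl h3) (Or.inl h4)
  obtain ⟨β, hβ, hβF, hβv, _⟩ := exists_swap hF (v := α w) (w := w')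
    (by
      rintro (h | h)
      · exact ne_of_r h5 h.symm
      · exact S.asymm _ _ h3 (h ▸ h5))
    (by
      rintro (h | h)
      · exact ne_of_r h4 h.symm
      · exact S.asymm _ _ h3 (Set.mem_singleton_iff.1 h ▸ h4))
    (by
      rintro x (rfl | rfl)
      · exact ⟨iff_of_true h5 h4, iff_of_false (S.asymm _ _ h5) (S.asymm _ _ h4)⟩
      · exact ⟨iff_of_false (fun h => n1 (Or.inl h)) fun h => n2 (Or.inl h),
          iff_of_false (fun h => n1 (Or.inr h)) fun h => n2 (Or.inr h)⟩)
    (u := α p) (Or.inl rfl) (Or.inl h5)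
  refine ⟨α.trans β, fun u v => ?_, hβF _ (Or.inr rfl), hβF _ (Or.inl rfl), hβv⟩
  rw [Equiv.trans_apply, Equiv.trans_apply, hβ, hα]

/-- The out-degree does not depend on the vertex. -/
theorem ncard_out_eq (x y : V) : {z | S.r x z}.ncard = {z | S.r y z}.ncard := by
  obtain ⟨α, hα, rfl⟩ := S.vt x y
  rw [← Set.ncard_image_of_injective _ α.injective]
  congr 1
  ext z
  constructor
  · rintro ⟨w, hw, rfl⟩
    exact (hα _ _).2 hw
  · intro h
    refine ⟨α.symm z, ?_, by simp⟩
    rw [Set.mem_ofPred_eq, ← hα]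
    simpa using h

theorem ncard_in_eq (x y : V) : {z | S.r z x}.ncard = {z | S.r z y}.ncard :=
  ncard_out_eq (S := S.rev) x y

end ClassedDigraph

/-! ### Rays, separators and ends -/

section Rays

variable {V : Type u} {G : SimpleGraph V}

theorem mem_of_mem_componentCompl {S T : Set V}
    (hT : ∀ u ∈ T, ∀ v, G.Adj u v → v ∈ T ∪ S) (C : G.ComponentCompl S) {u v : V}
    (hu : u ∈ C) (huT : u ∈ T) (hv : v ∈ C) : v ∈ T := by
  obtain ⟨hu', rfl⟩ := hu
  obtain ⟨hv', h⟩ := hv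
  have h := SimpleGraph.ConnectedComponent.exact h
  rw [SimpleGraph.reachable_comm, SimpleGraph.reachable_iff_reflTransGen] at h
  have key : ∀ w : ↥(Sᶜ : Set V), Relation.ReflTransGen (G.induce Sᶜ).Adj ⟨u, hu'⟩ w →
      (w : V) ∈ T := by
    intro w hw
    induction hw with
    | refl => exact huT
    | @tail b c _ hbc ih => exact (hT _ ih c hbc).resolve_right c.2
  exact key _ h

/-- Two rays that end up on different sides of a finite separator lie in different ends. -/
theorem nontrivial_ends_of_rays {S T : Set V} (hS : S.Finite)
    (hT : ∀ u ∈ T, ∀ v, G.Adj u v → v ∈ T ∪ S) (R R' : Ray G)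
    (hR : ∃ N, ∀ n, N ≤ n → R.vert n ∈ T) (hR' : ∃ N, ∀ n, N ≤ n → R'.vert n ∉ T) :
    Nontrivial (Quotient (raySetoid G)) := by
  refine ⟨⟦R⟧, ⟦R'⟧, fun h => ?_⟩
  obtain ⟨C, ⟨N1, h1⟩, N2, h2⟩ := Quotient.exact h S hS
  obtain ⟨N3, h3⟩ := hR
  obtain ⟨N4, h4⟩ := hR'
  exact h4 (max N2 N4) (le_max_right _ _)
    (mem_of_mem_componentCompl hT C (h1 (max N1 N3) (le_max_left _ _))
      (h3 (max N1 N3) (le_max_right _ _)) (h2 (max N2 N4) (le_max_left _ _)))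

theorem exists_adj_dist (hG : G.Connected) {u t : V} (h : u ≠ t) :
    ∃ v, G.Adj u v ∧ G.dist u t = G.dist v t + 1 := by
  obtain ⟨p, hp⟩ := hG.exists_walk_length_eq_dist u t
  cases p with
  | nil => exact absurd rfl h
  | @cons _ v _ huv q =>
    refine ⟨v, huv, ?_⟩
    have h1 : G.dist v t ≤ q.length := SimpleGraph.dist_le q
    have h2 : G.dist u t ≤ G.dist u v + G.dist v t := hG.dist_triangle
    have h3 : G.dist u v = 1 := SimpleGraph.dist_eq_one_iff_adj.2 huv
    rw [SimpleGraph.Walk.length_cons] at hp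
    omega

/-- In a locally finite connected graph, every infinite vertex set that is closed under adjacency
up to a finite set contains a tail of a ray. -/
theorem exists_ray_of_infinite (hG : G.Connected) (hfin : ∀ u, {v | G.Adj u v}.Finite)
    {S T : Set V} (hS : S.Finite) (hinf : T.Infinite)
    (hT : ∀ u ∈ T, ∀ v, G.Adj u v → v ∈ T ∪ S) :
    ∃ R : Ray G, ∃ N, ∀ n, N ≤ n → R.vert n ∈ T := by
  obtain ⟨o⟩ := hG.nonempty
  -- König's lemma along geodesics from o: `desc u` is the part of T lying beyond u, and some
  -- neighbour one step further from o inherits infinitely many of its vertices.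
  let desc : V → Set V := fun u => {t | t ∈ T ∧ G.dist o t = G.dist o u + G.dist u t}
  have hstep : ∀ u, (desc u).Infinite →
      ∃ v, G.Adj u v ∧ G.dist o v = G.dist o u + 1 ∧ (desc v).Infinite := by
    intro u hu
    by_contra! hcon
    refine hu (Set.Finite.subset (((hfin u).subset (Set.sep_subset _
      fun v => G.dist o v = G.dist o u + 1)).biUnion (t := desc) ?_ |>.insert u) ?_)
    · intro v hv
      exact hcon v hv.1 hv.2
    · intro t ht
      by_cases hut : u = t
      · exact Or.inl hut.symm
      · obtain ⟨v, huv, hd⟩ := exists_adj_dist hG hut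
        have h2 : G.dist o t ≤ G.dist o v + G.dist v t := hG.dist_triangle
        have h3 : G.dist o v ≤ G.dist o u + G.dist u v := hG.dist_triangle
        have h4 : G.dist u v = 1 := SimpleGraph.dist_eq_one_iff_adj.2 huv
        have h5 := ht.2
        refine Or.inr (Set.mem_iUnion₂.2 ⟨v, ⟨huv, ?_⟩, ht.1, ?_⟩) <;> omega
  choose! next hn1 hn2 hn3 using hstep
  have ho : (desc o).Infinite := by
    have : desc o = T := by
      ext t
      simp [desc]
    rwa [this]
  let c : ℕ → V := fun n => next^[n] o
  have hc : ∀ n, c (n + 1) = next (c n) := fun n => Function.iterate_succ_apply' _ _ _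
  have hci : ∀ n, (desc (c n)).Infinite := by
    intro n
    induction n with
    | zero => exact ho
    | succ n ih => rw [hc]; exact hn3 _ ih
  have hcd : ∀ n, G.dist o (c n) = n := by
    intro n
    induction n with
    | zero => simp [c]
    | succ n ih => rw [hc, hn2 _ (hci n), ih]
  obtain ⟨M, hM⟩ := (hS.image fun s => G.dist o s).bddAbove
  refine ⟨⟨c, fun i j hij => by rw [← hcd i, ← hcd j, hij], fun n => by
    rw [hc]; exact hn1 _ (hci n)⟩, M + 1, fun n hn => ?_⟩
  -- M bounds the distance from o to S. A geodesic leading from distance greater than M out to a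
  -- vertex of T avoids S, so membership in T propagates back along it.
  have key : ∀ d u t, t ∈ T → G.dist u t = d → G.dist o t = G.dist o u + d →
      M + 1 ≤ G.dist o u → u ∈ T := by
    intro d
    induction d with
    | zero =>
      intro u t ht hd _ _
      rw [(hG.dist_eq_zero_iff).1 hd]
      exact ht
    | succ d ih =>
      intro u t ht hd ho hu
      have hut : u ≠ t := by
        rintro rfl
        simp at hd
      obtain ⟨v, huv, hd'⟩ := exists_adj_dist hG hut
      have h2 : G.dist o t ≤ G.dist o v + G.dist v t := hG.dist_triangle
      have h3 : G.dist o v ≤ G.dist o u + G.dist u v := hG.dist_triangle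
      have h4 : G.dist u v = 1 := SimpleGraph.dist_eq_one_iff_adj.2 huv
      have hv : v ∈ T := ih v t ht (by omega) (by omega) (by omega)
      refine (hT v hv u huv.symm).resolve_right fun hus => ?_
      have : G.dist o u ≤ M := hM ⟨u, hus, rfl⟩
      omega
  obtain ⟨t, ht⟩ := (hci n).nonempty
  exact key _ (c n) t ht.1 rfl ht.2 (by rw [hcd]; exact hn)

theorem nontrivial_ends_of_infinite (hG : G.Connected) (hfin : ∀ u, {v | G.Adj u v}.Finite)
    {S T : Set V} (hS : S.Finite) (hinf : T.Infinite) (hinf' : Tᶜ.Infinite)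
    (hT : ∀ u ∈ T, ∀ v, G.Adj u v → v ∈ T ∪ S) :
    Nontrivial (Quotient (raySetoid G)) := by
  obtain ⟨R, hR⟩ := exists_ray_of_infinite hG hfin hS hinf hT
  obtain ⟨R', N, hR'⟩ := exists_ray_of_infinite hG hfin hS (T := Tᶜ \ S)
    (hinf'.sdiff hS) (by
      rintro u ⟨hu, huS⟩ v huv
      by_cases hv : v ∈ S
      · exact Or.inr hv
      · exact Or.inl ⟨fun hvT => (hT v hvT u huv.symm).elim hu huS, hv⟩)
  exact nontrivial_ends_of_rays hS hT R R' hR ⟨N, fun n hn => (hR' n hn).1⟩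

end Rays

/-! ### Acyclic layered digraphs -/

namespace ClassedDigraph

variable {V : Type u} {S : ClassedDigraph V}

theorem transGen_rev {x y : V} : Relation.TransGen S.rev.r x y ↔ Relation.TransGen S.r y x :=
  Relation.transGen_swap

/-- Later vertices of an infinite directed walk are reachable from earlier ones. -/
theorem transGen_of_lt {c : ℕ → V} (hc : ∀ n, S.r (c n) (c (n + 1))) {i j : ℕ} (hij : i < j) :
    Relation.TransGen S.r (c i) (c j) := by
  induction j, hij using Nat.le_induction with
  | base => exact .single (hc i)
  | succ k _ ih => exact ih.tail (hc k)

theorem exists_forward_ray (hac : ∀ v, ¬ Relation.TransGen S.r v v) (x : V) :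
    ∃ R : Ray S.graph, R.vert 0 = x ∧ ∀ i j, i < j →
      Relation.TransGen S.r (R.vert i) (R.vert j) := by
  choose next hnext using S.neOut
  have hc : ∀ n, S.r (next^[n] x) (next^[n + 1] x) := fun n => by
    rw [Function.iterate_succ_apply']
    exact hnext _
  have hlt := fun i j (hij : i < j) => transGen_of_lt (S := S) (c := fun n => next^[n] x) hc hij
  refine ⟨⟨fun n => next^[n] x, fun i j hij => ?_, fun n => Or.inl (hc n)⟩, rfl, hlt⟩
  rcases lt_trichotomy i j with h | h | h
  · have h1 := hlt i j h
    simp only at hij h1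
    rw [hij] at h1
    exact absurd h1 (hac _)
  · exact h
  · have h1 := hlt j i h
    simp only at hij h1
    rw [hij] at h1
    exact absurd h1 (hac _)

theorem exists_backward_ray (hac : ∀ v, ¬ Relation.TransGen S.r v v) (x : V) :
    ∃ R : Ray S.graph, R.vert 0 = x ∧ ∀ i j, i < j →
      Relation.TransGen S.r (R.vert j) (R.vert i) := by
  obtain ⟨R, h0, h⟩ := exists_forward_ray (S := S.rev)
    (fun v hv => hac v (transGen_rev.1 hv)) x
  exact ⟨⟨R.vert, R.injective, fun n => (R.adj n).symm⟩, h0, fun i j hij => transGen_rev.1 (h i j hij)⟩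

/-- If vertices with a common out-neighbour have the same in-neighbours and there is no directed
cycle, then there are at least two ends. -/
theorem nontrivial_ends_of_acyclic
    (hpull : ∀ a x x' b, S.r x b → S.r x' b → S.r a x → S.r a x')
    (hac : ∀ v, ¬ Relation.TransGen S.r v v) :
    Nontrivial (Quotient (raySetoid S.graph)) := by
  obtain ⟨a⟩ := S.conn.nonempty
  obtain ⟨s, hs⟩ := S.neOut a
  obtain ⟨R, hR0, hR⟩ := exists_forward_ray hac s
  obtain ⟨R', hR0', hR'⟩ := exists_backward_ray hac a
  -- The separator is N⁺(a), and T consists of the proper descendants of N⁺(a). By `hpull`, an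
  -- in-neighbour of a vertex of T has the same in-neighbours as the predecessor on a path from
  -- N⁺(a), so it lies in T or in N⁺(a). Acyclicity keeps the backward ray from a outside T.
  refine nontrivial_ends_of_rays (S := {x | S.r a x})
    (T := {v | ∃ s, S.r a s ∧ Relation.TransGen S.r s v}) (S.finOut a) ?_ R R'
    ⟨1, fun n hn => ⟨s, hs, hR0 ▸ hR 0 n hn⟩⟩ ⟨0, ?_⟩
  · rintro u ⟨s, hs, hsu⟩ v (huv | hvu)
    · exact Or.inl ⟨s, hs, hsu.tail huv⟩
    · obtain ⟨w, hsw, hwu⟩ := Relation.TransGen.tail'_iff.1 hsu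
      rcases Relation.ReflTransGen.cases_tail hsw with rfl | ⟨w', hsw', hw'⟩
      · exact Or.inr (hpull a _ v u hwu hvu hs)
      · exact Or.inl ⟨s, hs, Relation.TransGen.tail' hsw' (hpull w' w v u hwu hvu hw')⟩
  · rintro n - ⟨s, hs, hsn⟩
    rcases Nat.eq_zero_or_pos n with rfl | hn
    · rw [hR0'] at hsn
      exact hac a (.head hs hsn)
    · have := hR' 0 n hn
      rw [hR0'] at this
      exact hac a (Relation.TransGen.head hs (hsn.trans this))

end ClassedDigraph

/-! ### Directed cycles and blow-ups -/

theorem exists_seq_of_reflTransGen {V : Type*} {a : V → V → Prop} {x y : V}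
    (h : Relation.ReflTransGen a x y) :
    ∃ (n : ℕ) (c : ℕ → V), c 0 = x ∧ c n = y ∧ ∀ i < n, a (c i) (c (i + 1)) := by
  induction h with
  | refl => exact ⟨0, fun _ => x, rfl, rfl, fun i hi => absurd hi (by omega)⟩
  | @tail b z _ hbz ih =>
    obtain ⟨n, c, h0, hn, hc⟩ := ih
    refine ⟨n + 1, fun i => if i ≤ n then c i else z, by simp [h0], by simp, fun i hi => ?_⟩
    rcases Nat.lt_or_ge i n with h | h
    · simpa [show i ≤ n by omega, show i + 1 ≤ n by omega] using hc i h
    · obtain rfl : i = n := by omega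
      simpa [hn] using hbz

namespace ClassedDigraph

variable {V : Type u} {S : ClassedDigraph V}

/-- The digraph is isomorphic to the lexicographic product of a directed cycle of length at
least four and a nonempty edgeless digraph. -/
def IsCycleBlowup (S : ClassedDigraph V) : Prop :=
  ∃ m n : ℕ, 4 ≤ m ∧ 1 ≤ n ∧
    ∃ φ : V ≃ ZMod m × Fin n, ∀ u v, S.r u v ↔ (φ v).1 = (φ u).1 + 1

/-- A shortest directed cycle. -/
theorem exists_min_cycle {v : V} (hv : Relation.TransGen S.r v v) :
    ∃ (n : ℕ) (d : ZMod (n + 1) → V), (∀ i, S.r (d i) (d (i + 1))) ∧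
      ∀ i j, S.r (d j) (d (i + 1)) → j = i := by
  classical
  have hex : ∃ n, ∃ c : ℕ → V, (∀ i < n, S.r (c i) (c (i + 1))) ∧ S.r (c n) (c 0) := by
    obtain ⟨w, hvw, hwv⟩ := Relation.TransGen.head'_iff.1 hv
    obtain ⟨n, c, rfl, rfl, hc⟩ := exists_seq_of_reflTransGen hwv
    exact ⟨n, c, hc, hvw⟩
  obtain ⟨c, hc, hc0⟩ := Nat.find_spec hex
  have hmin := fun k => Nat.find_min hex (m := k)
  generalize Nat.find hex = n at *
  have hd : ∀ i : ZMod (n + 1), S.r (c i.val) (c (i + 1).val) := by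
    intro i
    have hlt := ZMod.val_lt i
    rcases Nat.lt_or_ge (i.val + 1) (n + 1) with h | h
    · have : (i + 1).val = i.val + 1 := by
        have h0 : ((i.val + 1 : ℕ) : ZMod (n + 1)) = i + 1 := by
          push_cast
          rw [ZMod.natCast_zmod_val]
        rw [← h0, ZMod.val_natCast_of_lt h]
      rw [this]
      exact hc _ (by omega)
    · have h1 : i.val = n := by omega
      have : i + 1 = 0 := by
        rw [← ZMod.natCast_zmod_val i, h1]
        exact_mod_cast ZMod.natCast_self (n + 1)
      rw [this, h1, ZMod.val_zero]
      exact hc0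
  refine ⟨n, fun i => c i.val, hd, fun i j hij => ?_⟩
  by_contra hne
  have hlt : (j - i - 1).val < n := by
    have h1 := ZMod.val_lt (j - i - 1)
    refine lt_of_le_of_ne (by omega) fun h2 => hne ?_
    have h3 : (j - i - 1) + 1 = 0 := by
      rw [← ZMod.natCast_zmod_val (j - i - 1), h2]
      exact_mod_cast ZMod.natCast_self (n + 1)
    linear_combination h3
  -- An edge d j → d (i + 1) with j ≠ i closes the segment d (i + 1), …, d j to a shorter cycle.
  refine hmin _ hlt ⟨fun t => c (i + 1 + (t : ZMod (n + 1))).val, fun t _ => ?_, ?_⟩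
  · have := hd (i + 1 + t)
    push_cast
    rwa [add_assoc (i + 1)] at this
  · have : i + 1 + (((j - i - 1).val : ℕ) : ZMod (n + 1)) = j := by
      rw [ZMod.natCast_zmod_val]
      ring
    simp only [this, Nat.cast_zero, add_zero]
    exact hij

/-- The sets N⁺(d i) along a shortest cycle d partition the vertices: by push and pull their union
is closed under adjacency, and a vertex in two of them would give an edge d (j + 1) → d (i + 2),
excluded by minimality. They are the fibres of the blow-up, all of size the out-degree. -/
theorem isCycleBlowup_of_cycle (hpush : ∀ a x x' b, S.r a x → S.r x b → S.r a x' → S.r x' b)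
    (hpull : ∀ a x x' b, S.r x b → S.r x' b → S.r a x → S.r a x')
    {v : V} (hv : Relation.TransGen S.r v v) : S.IsCycleBlowup := by
  obtain ⟨n, d, hd, hmin⟩ := exists_min_cycle hv
  have hout : ∀ {i v}, S.r (d i) v → S.r v (d (i + 1 + 1)) := fun h =>
    hpush _ _ _ _ (hd _) (hd _) h
  have hnext : ∀ {i v w}, S.r (d i) v → S.r v w → S.r (d (i + 1)) w := fun h h' =>
    hpush _ _ _ _ h h' (hd _)
  have hprev : ∀ {i v w}, S.r (d i) v → S.r w v → S.r (d (i - 1)) w := by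
    intro i v w h h'
    have h1 := hpull w _ _ _ (hout h) (hd _) h'
    have h2 := hd (i - 1)
    rw [sub_add_cancel] at h2
    exact hpull _ _ _ _ (hd i) h1 h2
  have hex : ∀ v, ∃ i, S.r (d i) v := by
    intro v
    induction connected_adj (S := S) (d 1) v with
    | refl => exact ⟨0, by simpa using hd 0⟩
    | tail _ hbc ih =>
      obtain ⟨i, hi⟩ := ih
      rcases hbc with h | h
      · exact ⟨_, hnext hi h⟩
      · exact ⟨_, hprev hi h⟩
  have huniq : ∀ {i j v}, S.r (d i) v → S.r (d j) v → j = i := by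
    intro i j v hi hj
    have := hmin _ _ (hpush _ _ _ _ hj (hout hi) (hd j))
    exact add_right_cancel this
  choose f hf using hex
  have hadj : ∀ u v, S.r u v ↔ f v = f u + 1 := by
    refine fun u v => ⟨fun h => huniq (hnext (hf u) h) (hf v), fun h => ?_⟩
    have h1 := hf v
    rw [h] at h1
    exact hpush _ _ _ _ (hd _) h1 (hf u)
  set k := {z | S.r v z}.ncard with hk
  have hfib : ∀ i, Nonempty ({u // f u = i} ≃ Fin k) := by
    intro i
    have h1 : {u | f u = i} = {z | S.r (d i) z} := by
      ext u
      exact ⟨fun h => by rw [← show f u = i from h]; exact hf u, fun h => huniq h (hf u)⟩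
    have h2 : Finite {u // f u = i} := by
      have : ({u | f u = i}).Finite := by rw [h1]; exact S.finOut _
      exact this.to_subtype
    refine ⟨Finite.equivFinOfCardEq ?_⟩
    rw [hk, ncard_out_eq v (d i), ← h1]
    exact Nat.card_coe_set_eq _
  let g' := fun i => (hfib i).some
  have hk1 : 1 ≤ k := by
    rw [hk, Nat.one_le_iff_ne_zero, Ne, Set.ncard_eq_zero (S.finOut v)]
    obtain ⟨y, hy⟩ := S.neOut v
    exact fun h => (h ▸ hy : y ∈ (∅ : Set V))
  have hm : 4 ≤ n + 1 := by
    by_contra hlt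
    have h01 := hd 0
    have h12 := hd 1
    have h23 := hd 2
    obtain rfl | rfl | rfl : n = 0 ∨ n = 1 ∨ n = 2 := by omega
    · exact irrefl _ h01
    · exact S.asymm _ _ h01 h12
    · exact S.tri _ _ _ (Or.inl h01) (Or.inl h12) (Or.inr h23)
  refine ⟨n + 1, k, hm, hk1, ((Equiv.sigmaFiberEquiv f).symm.trans
    (Equiv.sigmaCongrRight g')).trans (Equiv.sigmaEquivProd _ _), fun u v => ?_⟩
  rw [hadj]
  rfl

theorem nontrivial_ends_or_isCycleBlowup
    (hpush : ∀ a x x' b, S.r a x → S.r x b → S.r a x' → S.r x' b)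
    (hpull : ∀ a x x' b, S.r x b → S.r x' b → S.r a x → S.r a x') :
    Nontrivial (Quotient (raySetoid S.graph)) ∨ S.IsCycleBlowup := by
  by_cases hac : ∀ v, ¬ Relation.TransGen S.r v v
  · exact Or.inl (nontrivial_ends_of_acyclic hpull hac)
  · push Not at hac
    obtain ⟨v, hv⟩ := hac
    exact Or.inr (isCycleBlowup_of_cycle hpush hpull hv)

/-- The case of in-degree one. -/
theorem nontrivial_ends_or_isCycleBlowup_of_inDegree_one
    (hin : ∀ x y b, S.r x b → S.r y b → x = y) :
    Nontrivial (Quotient (raySetoid S.graph)) ∨ S.IsCycleBlowup := by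
  have hpull : ∀ a x x' b, S.r x b → S.r x' b → S.r a x → S.r a x' :=
    fun a x x' b h h' ha => hin _ _ _ h h' ▸ ha
  by_cases hac : ∀ v, ¬ Relation.TransGen S.r v v
  · exact Or.inl (nontrivial_ends_of_acyclic hpull hac)
  · push Not at hac
    obtain ⟨v, hv⟩ := hac
    refine Or.inr (isCycleBlowup_of_cycle ?_ hpull hv)
    have hper : ∀ y, Relation.TransGen S.r y y := by
      intro y
      obtain ⟨α, hα, rfl⟩ := S.vt v y
      exact Relation.TransGen.lift α (fun a b h => (hα a b).2 h) _ _ hv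
    choose p hp using S.neIn
    have hpu : ∀ {x y}, S.r x y → p y = x := fun h => hin _ _ _ (hp _) h
    have hpi : ∀ {x y}, Relation.ReflTransGen S.r x y → ∃ i, p^[i] y = x := by
      intro x y h
      induction h with
      | refl => exact ⟨0, rfl⟩
      | tail _ hbc ih =>
        obtain ⟨i, hi⟩ := ih
        exact ⟨i + 1, by rw [Function.iterate_succ_apply, hpu hbc, hi]⟩
    have hcyc : ∀ y, ∃ i, p^[i + 1] y = y := by
      intro y
      obtain ⟨w, hyw, hwy⟩ := Relation.TransGen.head'_iff.1 (hper y)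
      obtain ⟨i, hi⟩ := hpi hwy
      exact ⟨i, by rw [Function.iterate_succ_apply', hi, hpu hyw]⟩
    -- The predecessor map p is injective on periodic points: compare y and y' after a common
    -- period.
    have hout : ∀ x y y', S.r x y → S.r x y' → y = y' := by
      intro x y y' h h'
      obtain ⟨i, hi⟩ := hcyc y
      obtain ⟨j, hj⟩ := hcyc y'
      have h1 : p^[(i + 1) * (j + 1)] y = y := Function.IsPeriodicPt.mul_const hi (j + 1)
      have h2 : p^[(i + 1) * (j + 1)] y' = y' := Function.IsPeriodicPt.const_mul hj (i + 1)
      obtain ⟨N, hN⟩ : ∃ N, (i + 1) * (j + 1) = N + 1 := ⟨i * j + i + j, by ring⟩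
      rw [hN, Function.iterate_succ_apply, hpu h] at h1
      rw [hN, Function.iterate_succ_apply, hpu h'] at h2
      exact h1.symm.trans h2
    exact fun a x x' b h1 h2 h3 => hout _ _ _ h1 h3 ▸ h2

end ClassedDigraph

/-! ### Shortest shortcuts and complete bipartite classes -/

namespace ClassedDigraph

variable {V : Type u} {S : ClassedDigraph V}

/-- P is independent because its vertices share the neighbour u, so the rest of P can be adjoined to
F before swapping. Thus the automorphisms fixing F induce every transposition of P. -/
theorem exists_swap_fixing {F P : Set V} (hF : FinConn S.adj F) (hP : P.Finite)
    (hPF : ∀ p ∈ P, p ∉ F) (htype : ∀ p ∈ P, ∀ q ∈ P, S.SameType F p q) {u : V} (hu : u ∈ F)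
    (hPu : ∀ p ∈ P, S.adj u p) {p q : V} (hp : p ∈ P) (hq : q ∈ P) :
    ∃ α, S.Aut α ∧ (∀ u ∈ F, α u = u) ∧ α p = q ∧ α q = p ∧
      ∀ z ∈ P, z ≠ p → z ≠ q → α z = z := by
  have hF' : FinConn S.adj (F ∪ (P \ {p, q})) :=
    hF.union hP.sdiff fun z hz => ⟨u, hu, hPu z hz.1⟩
  have hind : ∀ x ∈ P, ∀ y ∈ P, ¬ S.adj x y := fun x hx y hy =>
    not_adj_of_common (adj_symm (hPu x hx)) (hPu y hy)
  obtain ⟨α, hα, hαF, h1, h2⟩ := exists_swap hF' (v := p) (w := q)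
    (by rintro (h | h); exacts [hPF p hp h, h.2 (Or.inl rfl)])
    (by rintro (h | h); exacts [hPF q hq h, h.2 (Or.inr rfl)])
    (by
      rintro z (hz | hz)
      · exact htype p hp q hq z hz
      · have h1 := hind z hz.1 p hp
        have h2 := hind z hz.1 q hq
        exact ⟨iff_of_false (fun h => h1 (Or.inl h)) fun h => h2 (Or.inl h),
          iff_of_false (fun h => h1 (Or.inr h)) fun h => h2 (Or.inr h)⟩)
    (u := u) (Or.inl hu) (hPu p hp)
  exact ⟨α, hα, fun v hv => hαF v (Or.inl hv), h1, h2, fun z hz hzp hzq =>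
    hαF z (Or.inr ⟨hz, by rintro (h | h); exacts [hzp h, hzq h]⟩)⟩

/-- Let all vertices of `P` be alike over `F`, and let `T` be a smaller set that is invariant under
the automorphisms fixing `F`. Then every vertex of `T` is related to all of `P` or to none. -/
theorem forall_of_ncard_lt {F P T : Set V} (hF : FinConn S.adj F) (hP : P.Finite)
    (hPF : ∀ p ∈ P, p ∉ F) (htype : ∀ p ∈ P, ∀ q ∈ P, S.SameType F p q) {u : V} (hu : u ∈ F)
    (hPu : ∀ p ∈ P, S.adj u p) (hTfin : T.Finite)
    (hT : ∀ α, S.Aut α → (∀ u ∈ F, α u = u) → ∀ t ∈ T, α t ∈ T)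
    {ρ : V → V → Prop} (hρ : ∀ α, S.Aut α → ∀ x y, ρ (α x) (α y) ↔ ρ x y)
    (hcard : T.ncard < P.ncard) {t p₀ : V} (ht : t ∈ T) (hp₀ : p₀ ∈ P) (h₀ : ρ p₀ t) :
    ∀ p ∈ P, ρ p t := by
  intro p₁ hp₁
  by_contra h₁
  have hswap := fun {p q : V} (hp : p ∈ P) (hq : q ∈ P) =>
    exists_swap_fixing hF hP hPF htype hu hPu hp hq
  -- Let A be the trace {q ∈ P | ρ q t}. Transpositions produce vertices of T with trace A (for p =
  -- p₀), A with p replaced by p₁ (for other p in A), and A with p₀ replaced by p (for p outside A).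
  -- These traces are pairwise distinct, so T has at least as many elements as P.
  have hblock : ∀ p ∈ P, ∃ t' ∈ T, ∀ q ∈ P, ρ q t' ↔
      (ρ p t ∧ p = p₀ ∧ ρ q t) ∨ (ρ p t ∧ p ≠ p₀ ∧ (ρ q t ∧ q ≠ p ∨ q = p₁)) ∨
        (¬ ρ p t ∧ (ρ q t ∧ q ≠ p₀ ∨ q = p)) := by
    intro p hp
    by_cases hpt : ρ p t
    · by_cases hpp : p = p₀
      · exact ⟨t, ht, fun q _ => by simp [hpp, h₀]⟩
      · have hne : p ≠ p₁ := fun h => h₁ (h ▸ hpt)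
        obtain ⟨α, hα, hαF, h1, h2, h3⟩ := hswap hp hp₁
        refine ⟨α t, hT α hα hαF t ht, fun q hq => ?_⟩
        by_cases hqp : q = p
        · have : ρ q (α t) ↔ ρ p₁ t := by rw [hqp, ← hρ α hα p₁ t, h2]
          subst hqp
          tauto
        · by_cases hqp₁ : q = p₁
          · have : ρ q (α t) ↔ ρ p t := by rw [hqp₁, ← hρ α hα p t, h1]
            tauto
          · have : ρ q (α t) ↔ ρ q t := by rw [← hρ α hα q t, h3 q hq hqp hqp₁]
            tauto
    · obtain ⟨α, hα, hαF, h1, h2, h3⟩ := hswap hp hp₀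
      refine ⟨α t, hT α hα hαF t ht, fun q hq => ?_⟩
      by_cases hqp : q = p
      · have : ρ q (α t) ↔ ρ p₀ t := by rw [hqp, ← hρ α hα p₀ t, h2]
        tauto
      · by_cases hqp₀ : q = p₀
        · have : ρ q (α t) ↔ ρ p t := by rw [hqp₀, ← hρ α hα p t, h1]
          tauto
        · have : ρ q (α t) ↔ ρ q t := by rw [← hρ α hα q t, h3 q hq hqp hqp₀]
          tauto
  choose! τ hτT hτ using hblock
  refine absurd (Set.ncard_le_ncard_of_injOn τ hτT (fun p hp q hq hpq => ?_) hTfin)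
    (not_le.2 hcard)
  have h : ∀ z ∈ P, ρ z (τ p) ↔ ρ z (τ q) := fun z _ => by rw [hpq]
  have e1 := h p hp
  have e2 := h q hq
  have e3 := h p₀ hp₀
  rw [hτ p hp _ hp, hτ q hq _ hp] at e1
  rw [hτ p hp _ hq, hτ q hq _ hq] at e2
  rw [hτ p hp _ hp₀, hτ q hq _ hp₀] at e3
  by_contra hne
  have n1 : ρ p t → p ≠ p₁ := fun h h' => h₁ (h' ▸ h)
  have n2 : ρ q t → q ≠ p₁ := fun h h' => h₁ (h' ▸ h)
  have n3 : p₀ ≠ p₁ := fun h => h₁ (h ▸ h₀)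
  grind

variable (S) in
/-- There is a walk of length `n` inside a class between two vertices such that a neighbour of the
first vertex outside the class is adjacent to the last vertex. -/
def HasShortcut (n : ℕ) : Prop :=
  ∃ (B : S.C) (c : ℕ → V) (p : V), (∀ i < n, S.e B (c i) (c (i + 1))) ∧ c 0 ≠ c n ∧
    S.adj p (c 0) ∧ ¬ S.e B p (c 0) ∧ S.adj p (c n)

theorem HasShortcut.of_rev {n : ℕ} (h : S.rev.HasShortcut n) : S.HasShortcut n := by
  obtain ⟨B, c, p, h1, h2, h3, h4, h5⟩ := h
  rw [rev_adj] at h3 h5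
  exact ⟨B, c, p, fun i hi => rev_e.1 (h1 i hi), h2, h3, fun h => h4 (rev_e.2 h), h5⟩

/-- Minimality makes all in-neighbours of c 0 look alike from c 0, …, c (m + 1). The set T of
σ-neighbours of c (m + 1) other than c m contains c (m + 2); discarding c m makes T strictly smaller
than N⁻(c 0), so `forall_of_ncard_lt` applies. -/
theorem shortcut_spread {B : S.C} {c : ℕ → V} {p : V} {m : ℕ}
    (hmin : ∀ i < m + 2, ¬ S.HasShortcut i) (hc : ∀ i < m + 2, S.e B (c i) (c (i + 1)))
    (hne : c 0 ≠ c (m + 2)) (hp : S.r p (c 0)) (hB : S.oc (c 0) = B)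
    {ρ σ : V → V → Prop} (hρ : ∀ α, S.Aut α → ∀ x y, ρ (α x) (α y) ↔ ρ x y)
    (hσ : ∀ α, S.Aut α → ∀ x y, σ (α x) (α y) ↔ σ x y) (hρadj : ∀ x y, ρ x y → S.adj x y)
    (hσfin : {t | σ t (c (m + 1))}.Finite) (hm : σ (c m) (c (m + 1)))
    (hm2 : σ (c (m + 2)) (c (m + 1)))
    (hcard : {t | σ t (c (m + 1))}.ncard ≤ {q | S.r q (c 0)}.ncard) (hρp : ρ p (c (m + 2))) :
    ∀ q, S.r q (c 0) → ρ q (c (m + 2)) := by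
  have hout : ∀ q, S.r q (c 0) → ¬ S.e B q (c 0) := by
    rintro q hq (⟨_, h⟩ | ⟨h, _⟩)
    · exact S.ne (c 0) (by rw [hB, ← h, S.edge q _ hq])
    · exact S.asymm _ _ h hq
  -- A return to c 0 could be cut off, leaving a shorter shortcut.
  have h1 : ∀ i, 1 ≤ i → i ≤ m + 1 → c i ≠ c 0 := by
    intro i hi1 hi2 h
    refine hmin (m + 2 - i) (by omega) ⟨B, fun j => c (i + j), p, fun j hj => hc (i + j) (by omega),
      ?_, ?_, ?_, ?_⟩
    · simp only [add_zero]
      rw [h, show i + (m + 2 - i) = m + 2 by omega]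
      exact hne
    · show S.adj p (c (i + 0))
      rw [add_zero, h]
      exact Or.inl hp
    · simpa [h] using hout p hp
    · show S.adj p (c (i + (m + 2 - i)))
      rw [show i + (m + 2 - i) = m + 2 by omega]
      exact hρadj _ _ hρp
  have h2 : ∀ q, S.r q (c 0) → ∀ i, 1 ≤ i → i ≤ m + 1 → ¬ S.adj q (c i) :=
    fun q hq i hi1 hi2 hadj => hmin i (by omega) ⟨B, c, q, fun j hj => hc j (by omega),
      (h1 i hi1 hi2).symm, Or.inl hq, hout q hq, hadj⟩
  have h3 : ∀ q, S.r q (c 0) → ∀ i, i ≤ m + 1 → c i ≠ q := by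
    rintro q hq i hi rfl
    rcases Nat.lt_or_ge i 2 with h | h
    · interval_cases i
      · exact irrefl _ hq
      · exact hout _ hq (e_symm (hc 0 (by omega)))
    · have := e_adj (hc (i - 1) (by omega))
      rw [show i - 1 + 1 = i by omega] at this
      exact h2 _ hq (i - 1) (by omega) (by omega) (adj_symm this)
  have hF : FinConn S.adj {v | ∃ i ≤ m + 1, c i = v} :=
    FinConn.image_chain c (m + 1) fun i hi => e_adj (hc i (by omega))
  refine forall_of_ncard_lt hF (S.finIn (c 0)) ?_ ?_ (u := c 0) ⟨0, by omega, rfl⟩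
    (fun q hq => Or.inr hq) (T := {t | σ t (c (m + 1))} \ {c m}) (hσfin.sdiff) ?_ hρ ?_
    ⟨hm2, ?_⟩ hp hρp
  · rintro q hq ⟨i, hi, h⟩
    exact h3 q hq i hi h
  · rintro q hq q' hq' _ ⟨i, hi, rfl⟩
    rcases Nat.eq_zero_or_pos i with rfl | hi0
    · exact ⟨iff_of_false (S.asymm _ _ hq) (S.asymm _ _ hq'), iff_of_true hq hq'⟩
    · have n1 := h2 q hq i hi0 hi
      have n2 := h2 q' hq' i hi0 hi
      exact ⟨iff_of_false (fun h => n1 (Or.inr h)) fun h => n2 (Or.inr h),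
        iff_of_false (fun h => n1 (Or.inl h)) fun h => n2 (Or.inl h)⟩
  · rintro α hα hαF t ⟨ht, htm⟩
    have f1 : α (c (m + 1)) = c (m + 1) := hαF _ ⟨m + 1, le_rfl, rfl⟩
    have f2 : α (c m) = c m := hαF _ ⟨m, by omega, rfl⟩
    refine ⟨?_, fun h => htm (α.injective (by rw [h, f2]))⟩
    rw [Set.mem_ofPred_eq, ← f1, hσ α hα]
    exact ht
  · exact (Set.ncard_sdiff_singleton_lt_of_mem (s := {t | σ t (c (m + 1))}) hm (hs := hσfin)).trans_le hcard
  · intro h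
    have h : c (m + 2) = c m := h
    rcases Nat.eq_zero_or_pos m with rfl | hm0
    · exact hne h.symm
    · refine h2 p hp m hm0 (by omega) ?_
      rw [← h]
      exact hρadj _ _ hρp

variable (S) in
/-- In-neighbourhoods spread along a pair of out-neighbours, or along a directed path with three
vertices. -/
def Spreads : Prop :=
  (∃ p y z, S.r p y ∧ S.r p z ∧ y ≠ z ∧ ∀ q, S.r q y → S.r q z) ∨
    ∃ u p w, S.r u p ∧ S.r p w ∧ ∀ q, S.r q w → S.r u q

/-- As oc (c 0) = B, the vertex p is an in-neighbour of c 0. If the walk ends at a tail, T is cut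
from an in-neighbourhood, of the same size as N⁻(c 0). If it ends at a head, T is cut from an
out-neighbourhood, and counting fails only when the in-degree is smaller than the out-degree. -/
theorem spreads_of_shortcut {B : S.C} {c : ℕ → V} {p : V} {n : ℕ}
    (hmin : ∀ i < n, ¬ S.HasShortcut i) (hc : ∀ i < n, S.e B (c i) (c (i + 1)))
    (hne : c 0 ≠ c n) (hp : S.adj p (c 0)) (hpe : ¬ S.e B p (c 0)) (hpn : S.adj p (c n))
    (hB : S.oc (c 0) = B) :
    S.Spreads ∨ (S.ic (c n) = B ∧ {q | S.r q (c 0)}.ncard < {q | S.r (c 0) q}.ncard) := by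
  have hp : S.r p (c 0) := hp.resolve_right fun h => hpe (Or.inr ⟨h, hB⟩)
  have hn : 2 ≤ n := by
    by_contra hlt
    obtain rfl | rfl : n = 0 ∨ n = 1 := by omega
    · exact hne rfl
    · exact not_adj_of_common (Or.inl hp) (e_adj (hc 0 one_pos)) hpn
  obtain ⟨m, rfl⟩ := Nat.exists_eq_add_of_le' hn
  have hr : ∀ α, S.Aut α → ∀ x y, S.r (α x) (α y) ↔ S.r x y := fun α hα x y => hα x y
  have hr' : ∀ α, S.Aut α → ∀ x y, S.r (α y) (α x) ↔ S.r y x := fun α hα x y => hα y x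
  rcases hc (m + 1) (by omega) with ⟨hlast, hlB⟩ | ⟨hlast, hlB⟩
  · have hicn : S.ic (c (m + 2)) = B := by rw [← S.edge _ _ hlast, hlB]
    have hm : S.r (c (m + 1)) (c m) := by
      rcases hc m (by omega) with ⟨h, h'⟩ | ⟨h, -⟩
      · exact absurd ((S.edge _ _ h).symm.trans (h'.trans hlB.symm)) (S.ne _)
      · exact h
    rcases lt_or_ge {q | S.r q (c 0)}.ncard {q | S.r (c 0) q}.ncard with hlt | hge
    · exact Or.inr ⟨hicn, hlt⟩
    · left
      right
      have hpn : S.r (c (m + 2)) p := by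
        refine hpn.resolve_left fun h => hpe (Or.inl ⟨hp, ?_⟩)
        rw [S.edge _ _ h, hicn]
      refine ⟨c (m + 2), p, c 0, hpn, hp, ?_⟩
      refine shortcut_spread hmin hc hne hp hB (ρ := fun x y => S.r y x) (σ := fun x y => S.r y x)
        hr' hr' (fun x y h => Or.inr h) (S.finOut _) hm hlast ?_ hpn
      rw [ncard_out_eq (c (m + 1)) (c 0)]
      exact hge
  · have hicm : S.ic (c (m + 1)) = B := by rw [← S.edge _ _ hlast, hlB]
    have hm : S.r (c m) (c (m + 1)) := by
      rcases hc m (by omega) with ⟨h, -⟩ | ⟨h, h'⟩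
      · exact h
      · exact absurd (hicm.trans h'.symm) (S.ne _)
    left
    have hcard := (ncard_in_eq (S := S) (c (m + 1)) (c 0)).le
    rcases hpn with hpn | hpn
    · exact Or.inl ⟨p, c 0, c (m + 2), hp, hpn, hne,
        shortcut_spread hmin hc hne hp hB (ρ := S.r) (σ := S.r) hr hr (fun x y h => Or.inl h)
          (S.finIn _) hm hlast hcard hpn⟩
    · exact Or.inr ⟨c (m + 2), p, c 0, hpn, hp,
        shortcut_spread hmin hc hne hp hB (ρ := fun x y => S.r y x) (σ := S.r) hr' hr
          (fun x y h => Or.inr h) (S.finIn _) hm hlast hcard hpn⟩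

/-- In the exceptional case, reverse both the walk and all edges: a second failure would give the
opposite strict inequality between the degrees. -/
theorem spreads_of_min_shortcut {n : ℕ} (hmin : ∀ i < n, ¬ S.HasShortcut i)
    (h : S.HasShortcut n) : S.Spreads ∨ S.rev.Spreads := by
  have key : ∀ (S : ClassedDigraph V), (∀ i < n, ¬ S.HasShortcut i) →
      ∀ (B : S.C) (c : ℕ → V) (p : V), (∀ i < n, S.e B (c i) (c (i + 1))) → c 0 ≠ c n →
      S.adj p (c 0) → ¬ S.e B p (c 0) → S.adj p (c n) → S.oc (c 0) = B →
      S.Spreads ∨ S.rev.Spreads := by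
    intro S hmin B c p hc hne hp hpe hpn hB
    rcases spreads_of_shortcut hmin hc hne hp hpe hpn hB with h | ⟨hicn, hlt⟩
    · exact Or.inl h
    · have hmin' : ∀ i < n, ¬ S.rev.HasShortcut i := fun i hi h => hmin i hi h.of_rev
      have hp0 : S.r p (c 0) := hp.resolve_right fun h => hpe (Or.inr ⟨h, hB⟩)
      have hpe' : ¬ S.e B p (c n) := by
        rintro (⟨h, h'⟩ | ⟨h, h'⟩)
        · exact hpe (Or.inl ⟨hp0, h'⟩)
        · exact S.ne _ (hicn.trans h'.symm)
      rcases spreads_of_shortcut (S := S.rev) (B := B) (c := fun i => c (n - i)) (p := p) hmin'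
        (fun i hi => by
          have := e_symm (hc (n - (i + 1)) (by omega))
          rw [show n - (i + 1) + 1 = n - i by omega] at this
          exact rev_e.2 this) (by simpa using hne.symm) (by simpa [rev_adj] using hpn)
        (fun h => hpe' (rev_e.1 h)) (by simpa [rev_adj] using hp) hicn with h | ⟨_, h⟩
      · exact Or.inr h
      · have h1 : {q | S.r (c n) q}.ncard < {q | S.r q (c n)}.ncard := h
        rw [ncard_out_eq _ (c 0), ncard_in_eq _ (c 0)] at h1
        omega
  obtain ⟨B, c, p, hc, hne, hp, hpe, hpn⟩ := h
  by_cases hB : S.oc (c 0) = B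
  · exact key S hmin B c p hc hne hp hpe hpn hB
  · have hB' : S.ic (c 0) = B := by
      rcases n with _ | n
      · exact absurd rfl hne
      · rcases hc 0 (by omega) with ⟨_, h⟩ | ⟨h, h'⟩
        · exact absurd h hB
        · rw [← S.edge _ _ h, h']
    have := key S.rev (fun i hi h => hmin i hi h.of_rev) B c p (fun i hi => rev_e.2 (hc i hi)) hne
      (by rwa [rev_adj]) (fun h => hpe (rev_e.1 h)) (by rwa [rev_adj]) hB'
    exact this.symm

variable (S) in
/-- Every class is complete bipartite: there is no induced alternating path with three edges. -/
def CompleteClasses : Prop := ∀ x x' y y', S.r x y → S.r x' y → S.r x y' → S.r x' y'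

/-- If N⁻(y) ⊆ N⁻(z) for one pair of distinct out-neighbours of a vertex, transitivity on such pairs
gives it for all, which is completeness. The directed-path alternative reduces to this: it holds for
all directed paths of three vertices, and is applied to two in-neighbours of w. -/
theorem completeClasses_of_spreads (hl : ∀ w, ∃ x x', x ≠ x' ∧ S.r x w ∧ S.r x' w)
    (h : S.Spreads) : S.CompleteClasses := by
  have key : ∀ p y z, S.r p y → S.r p z → y ≠ z → (∀ q, S.r q y → S.r q z) →
      S.CompleteClasses := by
    intro p y z hy hz hne hq x x' b b' h1 h2 h3
    by_cases hbb : b = b'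
    · exact hbb ▸ h2
    obtain ⟨α, hα, rfl, rfl, rfl⟩ := exists_aut_out_pair hy hz hne h1 h3 hbb
    have := hq (α.symm x') (by rw [← hα]; simpa using h2)
    rw [← hα] at this
    simpa using this
  rcases h with ⟨p, y, z, hy, hz, hne, hq⟩ | ⟨u, p, w, h1, h2, hq⟩
  · exact key p y z hy hz hne hq
  · have hall : ∀ u p w, S.r u p → S.r p w → ∀ q, S.r q w → S.r u q := by
      intro u' p' w' h3 h4 q h5
      obtain ⟨α, hα, rfl, rfl, rfl⟩ := exists_aut_two_arc h1 h2 h3 h4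
      have := hq (α.symm q) (by rw [← hα]; simpa using h5)
      rw [← hα] at this
      simpa using this
    obtain ⟨x, x', hne, hx, hx'⟩ := hl w
    obtain ⟨a, ha⟩ := S.neIn x
    exact key a x x' ha (hall a x w ha hx x' hx') hne fun q hq => hall q x w hq hx x' hx'

theorem CompleteClasses.of_rev (h : S.rev.CompleteClasses) : S.CompleteClasses :=
  fun x x' y y' h1 h2 h3 => h y y' x x' h1 h3 h2

/-- Along a walk in the class starting at x, every tail keeps a common out-neighbour with x and
every head is an out-neighbour of x. -/
theorem CompleteClasses.r_of_oc_eq_ic (h : S.CompleteClasses) {x y : V} (hxy : S.oc x = S.ic y) :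
    S.r x y := by
  have key : ∀ v, Relation.ReflTransGen (fun a b => (S.r a b ∧ S.oc a = S.oc x) ∨
      (S.r b a ∧ S.oc b = S.oc x)) x v →
      (S.oc v = S.oc x ∧ ∃ w, S.r x w ∧ S.r v w) ∨ (S.ic v = S.oc x ∧ S.r x v) := by
    intro v hv
    induction hv with
    | refl =>
      obtain ⟨w, hw⟩ := S.neOut x
      exact Or.inl ⟨rfl, w, hw, hw⟩
    | @tail b c _ hbc ih =>
      rcases hbc with ⟨h1, h2⟩ | ⟨h1, h2⟩
      · rcases ih with ⟨_, w, h3, h4⟩ | ⟨h3, _⟩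
        · exact Or.inr ⟨by rw [← S.edge _ _ h1, h2], h b x w c h4 h3 h1⟩
        · exact absurd (h3.trans h2.symm) (S.ne b)
      · rcases ih with ⟨h3, _⟩ | ⟨_, h3⟩
        · exact absurd (((S.edge _ _ h1).symm.trans h2).trans h3.symm) (S.ne b)
        · exact Or.inl ⟨h2, b, h3, h1⟩
  rcases key y (S.chain _ x y (Or.inr rfl) (Or.inl hxy.symm)) with ⟨h1, _⟩ | ⟨_, h1⟩
  · exact absurd (hxy.symm.trans h1.symm) (S.ne y)
  · exact h1

/-- If two vertices with a common in-neighbour have their out-edges in the same class, then the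
digraph is layered. -/
theorem nontrivial_ends_or_isCycleBlowup_of_oc_eq (hk : ∀ w, ∃ x x', x ≠ x' ∧ S.r w x ∧ S.r w x')
    (hl : ∀ w, ∃ x x', x ≠ x' ∧ S.r x w ∧ S.r x' w) {a y y' : V} (hy : S.r a y) (hy' : S.r a y')
    (hne : y ≠ y') (hoc : S.oc y = S.oc y') :
    Nontrivial (Quotient (raySetoid S.graph)) ∨ S.IsCycleBlowup := by
  classical
  have hK : S.CompleteClasses := by
    -- The class containing the out-edges of y and y' joins them by a walk, while the edges from a
    -- to them lie outside it.
    have hex : ∃ n, S.HasShortcut n := by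
      obtain ⟨n, c, h0, hn, hc⟩ := exists_seq_of_reflTransGen
        (S.chain (S.oc y) y y' (Or.inr rfl) (Or.inr hoc.symm))
      refine ⟨n, S.oc y, c, a, hc, by rwa [h0, hn], by rw [h0]; exact Or.inl hy, ?_,
        by rw [hn]; exact Or.inl hy'⟩
      rw [h0]
      rintro (⟨_, h⟩ | ⟨h, _⟩)
      · exact S.ne y (by rw [← S.edge _ _ hy, h])
      · exact S.asymm _ _ hy h
    rcases spreads_of_min_shortcut (fun i hi => Nat.find_min hex hi) (Nat.find_spec hex) with h | h
    · exact completeClasses_of_spreads hl h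
    · exact (completeClasses_of_spreads (S := S.rev) hk h).of_rev
  have hocall : ∀ {a x x'}, S.r a x → S.r a x' → S.oc x = S.oc x' := by
    intro b x x' hx hx'
    by_cases hxx : x = x'
    · rw [hxx]
    obtain ⟨α, hα, rfl, rfl, rfl⟩ := exists_aut_out_pair hy hy' hne hx hx' hxx
    exact hα.oc_eq hoc
  have hpush : ∀ a x x' b, S.r a x → S.r x b → S.r a x' → S.r x' b := fun a x x' b h1 h2 h3 =>
    hK.r_of_oc_eq_ic (by rw [hocall h3 h1, S.edge _ _ h2])
  refine nontrivial_ends_or_isCycleBlowup hpush fun a' x x' b h1 h2 h3 => hK.r_of_oc_eq_ic ?_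
  by_cases hxx : x = x'
  · rw [← hxx, S.edge _ _ h3]
  -- By push, y and y' also share an out-neighbour, and both in-edges from a lie in one class;
  -- transitivity on pairs of in-neighbours carries this to x and x'.
  obtain ⟨b₀, hb₀⟩ := S.neOut y
  have hb₀' := hpush a y y' b₀ hy hb₀ hy'
  obtain ⟨α, hα, _, rfl, rfl⟩ := exists_aut_out_pair (S := S.rev) hb₀ hb₀' hne h1 h2 hxx
  rw [S.edge _ _ h3]
  exact (rev_aut hα).ic_eq ((S.edge _ _ hy).symm.trans (S.edge _ _ hy'))

end ClassedDigraph

/-! ### The splitting case -/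

namespace ClassedDigraph

variable {V : Type u} {S : ClassedDigraph V}

variable (S) in
/-- Every vertex has several in- and out-neighbours, the in-neighbours lie in different in-classes
and the out-neighbours lie in different out-classes. -/
structure Splits : Prop where
  out_two : ∀ w, ∃ x x', x ≠ x' ∧ S.r w x ∧ S.r w x'
  in_two : ∀ w, ∃ x x', x ≠ x' ∧ S.r x w ∧ S.r x' w
  out_ne : ∀ {a y y'}, S.r a y → S.r a y' → y ≠ y' → S.oc y ≠ S.oc y'
  in_ne : ∀ {a y y'}, S.r y a → S.r y' a → y ≠ y' → S.ic y ≠ S.ic y'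

theorem Splits.rev (h : S.Splits) : S.rev.Splits := ⟨h.in_two, h.out_two, h.in_ne, h.out_ne⟩

theorem Splits.out_other (h : S.Splits) (w x : V) : ∃ x', x' ≠ x ∧ S.r w x' := by
  obtain ⟨y, y', hne, hy, hy'⟩ := h.out_two w
  by_cases hyx : y = x
  · exact ⟨y', fun h => hne (hyx.trans h.symm), hy'⟩
  · exact ⟨y, hyx, hy⟩

/-- By arc transitivity equality would hold on every edge, giving all out-neighbours of u the same
out-class. -/
theorem Splits.oc_ne_ic (h : S.Splits) {u v : V} (huv : S.r u v) : S.oc v ≠ S.ic u := by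
  intro heq
  have key : ∀ g p, S.r g p → S.oc p = S.ic g := by
    intro g p hgp
    obtain ⟨α, hα, rfl, rfl⟩ := exists_aut_arc huv hgp
    exact hα.oc_ic_eq heq
  obtain ⟨y, y', hne, hy, hy'⟩ := h.out_two u
  exact h.out_ne hy hy' hne ((key _ _ hy).trans (key _ _ hy').symm)

/-- The out-classes of the ends of directed paths that branch after their first vertex are
different. -/
theorem Splits.oc_ne_of_branch (h : S.Splits) {g p p' a a' : V} (hp : S.r g p) (hp' : S.r g p')
    (hne : p ≠ p') (ha : S.r p a) (ha' : S.r p' a') : S.oc a ≠ S.oc a' := by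
  intro heq
  -- Swapping a' with another out-neighbour b of p', with g, p, p' and a fixed, would turn oc a = oc
  -- a' into oc a = oc b, although a' and b have different out-classes.
  obtain ⟨b, hb, hpb⟩ := h.out_other p' a'
  have e1 := S.edge _ _ hp
  have e2 := S.edge _ _ hp'
  have e3 := S.edge _ _ ha
  have e4 := S.edge _ _ ha'
  have e5 := S.edge _ _ hpb
  have hpp := h.out_ne hp hp' hne
  have hF : FinConn S.adj {p', p, g} :=
    ((FinConn.single g).cons rfl (Or.inl hp)).cons (Or.inr rfl) (Or.inl hp')
  have hg : ∀ x, S.r p' x → ¬ S.adj g x := fun x hx => not_adj_of_common (Or.inl hp') (Or.inl hx)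
  have hpx : ∀ x, S.r p' x → ¬ S.adj p x := by
    rintro x hx (hpx | hpx)
    · exact hpp ((S.edge _ _ hpx).trans (S.edge _ _ hx).symm)
    · exact h.oc_ne_ic hx ((S.edge _ _ hpx).trans (e1.symm.trans e2))
  have hnot : ∀ x, S.r p' x → x ∉ ({p', p, g} : Set V) := by
    rintro x hx (rfl | rfl | hxg)
    · exact irrefl _ hx
    · exact hg _ hx (Or.inl hp)
    · rw [Set.mem_singleton_iff.1 hxg] at hx
      exact S.asymm _ _ hp' hx
  have htype : S.SameType {p', p, g} a' b := by
    rintro z (rfl | rfl | hz)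
    · exact ⟨iff_of_true ha' hpb, iff_of_false (S.asymm _ _ ha') (S.asymm _ _ hpb)⟩
    · have n1 := hpx _ ha'
      have n2 := hpx _ hpb
      exact ⟨iff_of_false (fun h => n1 (Or.inl h)) fun h => n2 (Or.inl h),
        iff_of_false (fun h => n1 (Or.inr h)) fun h => n2 (Or.inr h)⟩
    · rw [Set.mem_singleton_iff.1 hz]
      have n1 := hg _ ha'
      have n2 := hg _ hpb
      exact ⟨iff_of_false (fun h => n1 (Or.inl h)) fun h => n2 (Or.inl h),
        iff_of_false (fun h => n1 (Or.inr h)) fun h => n2 (Or.inr h)⟩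
  -- The one adjacency through which a might distinguish a' from b; it is excluded by swapping a'
  -- and b over {p', p, g} only.
  have hba : ¬ S.r b a := by
    intro hba
    obtain ⟨α, hα, hαF, _, h2⟩ := exists_swap hF (hnot _ ha') (hnot _ hpb) htype (Or.inl rfl)
      (Or.inl ha')
    have := hα.oc_eq ((S.edge _ _ hba).trans e3.symm)
    rw [h2, hαF p (Or.inr (Or.inl rfl)), e3, ← heq] at this
    exact S.ne a this.symm
  have hF' : FinConn S.adj (insert a {p', p, g}) := hF.cons (Or.inr (Or.inl rfl)) (Or.inl ha)
  have haa : ∀ x, S.r p' x → ¬ S.r a x := fun x hx hax =>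
    S.ne a' (by rw [← e4, ← heq, S.edge _ _ hax, S.edge _ _ hx])
  have ha'a : ¬ S.r a' a := fun hr => S.ne a (by rw [← S.edge _ _ hr, heq])
  have hne_a : ∀ x, S.r p' x → x ≠ a := by
    rintro x hx rfl
    exact hpx _ hx (Or.inl ha)
  obtain ⟨α, hα, hαF, h1, _⟩ := exists_swap hF' (v := a') (w := b)
    (by rintro (h | h); exacts [hne_a _ ha' h, hnot _ ha' h])
    (by rintro (h | h); exacts [hne_a _ hpb h, hnot _ hpb h])
    (by
      rintro z (rfl | hz)
      · exact ⟨iff_of_false (haa _ ha') (haa _ hpb), iff_of_false ha'a hba⟩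
      · exact htype z hz) (u := p') (Or.inr (Or.inl rfl)) (Or.inl ha')
  have := hα.oc_eq heq
  rw [hαF a (Or.inl rfl), h1] at this
  exact h.out_ne ha' hpb hb.symm (heq.symm.trans this)

/-- If v is moved, then v and α v have equal out-classes but different in-classes. This keeps the
in-neighbours of v out of K, hence in R, and, with `oc_ne_of_branch`, non-adjacent to K. Two of them
can then be swapped over K ∪ {v}, whereas `hfix` makes that automorphism trivial on R. -/
theorem Splits.not_moved_of_in (h : S.Splits) {K R : Set V} (hK : FinConn S.adj K)
    (hR : ∀ u ∈ R, ∀ v, S.adj u v → v ∈ R ∪ K)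
    (hfix : ∀ v ∈ R, ∀ f ∈ K, S.adj f v → ∀ β, S.Aut β → (∀ u ∈ K, β u = u) → β v = v →
      ∀ w ∈ R, β w = w)
    {v f : V} (hv : v ∈ R) (hf : f ∈ K) (hvf : S.r v f) {α : Equiv.Perm V} (hα : S.Aut α)
    (hαK : ∀ u ∈ K, α u = u) (hαv : α v ≠ v) : False := by
  have hα' : ∀ {x q}, q ∈ K → (S.r (α x) q ↔ S.r x q) ∧ (S.r q (α x) ↔ S.r q x) := by
    intro x q hq
    rw [← hα x q, ← hα q x, hαK q hq]
    exact ⟨Iff.rfl, Iff.rfl⟩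
  have hvf' : S.r (α v) f := (hα' hf).1.2 hvf
  have hic : S.ic (α v) ≠ S.ic v := h.in_ne hvf' hvf hαv
  have hocv : S.oc (α v) = S.oc v := (S.edge _ _ hvf').trans (S.edge _ _ hvf).symm
  have hnK : ∀ p, S.r p v → p ∉ K := fun p hp hpK =>
    hic ((S.edge _ _ ((hα' hpK).2.2 hp)).symm.trans (S.edge _ _ hp))
  have hpR : ∀ p, S.r p v → p ∈ R := fun p hp =>
    (hR v hv p (Or.inr hp)).resolve_right (hnK p hp)
  have hna : ∀ p, S.r p v → ∀ q ∈ K, ¬ S.adj q p := by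
    intro p hp q hq hqp
    have hmove : α p ≠ p := fun hpp => hαv (hfix p (hpR p hp) q hq hqp α hα hαK hpp v hv)
    have hp' : S.r (α p) (α v) := (hα _ _).2 hp
    rcases hqp with hqp | hpq
    · exact h.oc_ne_of_branch ((hα' hq).2.2 hqp) hqp hmove hp' hp hocv
    · have := (S.edge _ _ ((hα' hq).1.2 hpq)).trans (S.edge _ _ hpq).symm
      rw [S.edge _ _ hp', S.edge _ _ hp] at this
      exact hic this
  obtain ⟨p, p', hne, hp, hp'⟩ := h.in_two v
  have hnot : ∀ p, S.r p v → p ∉ insert v K := by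
    rintro p hp (rfl | hpK)
    · exact irrefl _ hp
    · exact hnK p hp hpK
  obtain ⟨β, hβ, hβK, hβp, _⟩ := exists_swap (hK.cons hf (Or.inr hvf)) (hnot p hp) (hnot p' hp')
    (by
      rintro z (rfl | hz)
      · exact ⟨iff_of_false (S.asymm _ _ hp) (S.asymm _ _ hp'), iff_of_true hp hp'⟩
      · have n1 := hna p hp z hz
        have n2 := hna p' hp' z hz
        exact ⟨iff_of_false (fun h => n1 (Or.inl h)) fun h => n2 (Or.inl h),
          iff_of_false (fun h => n1 (Or.inr h)) fun h => n2 (Or.inr h)⟩)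
    (u := v) (Or.inl rfl) (Or.inr hp)
  have := hfix v hv f hf (Or.inr hvf) β hβ (fun u hu => hβK u (Or.inr hu)) (hβK v (Or.inl rfl)) p
    (hpR p hp)
  exact hne (this.symm.trans hβp)

/-- An automorphism fixing a finite connected set pointwise also fixes every finite set that is
attached to it. -/
theorem Splits.eq_of_fixes (h : S.Splits) {K R : Set V} (hRfin : R.Finite)
    (hK : FinConn S.adj K) (hR : ∀ u ∈ R, ∀ v, S.adj u v → v ∈ R ∪ K) (hKR : Disjoint K R)
    {α : Equiv.Perm V} (hα : S.Aut α) (hαK : ∀ u ∈ K, α u = u) : ∀ w ∈ R, α w = w := by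
  -- Induction on |R|: a fixed vertex of R adjacent to K is moved into K, so it suffices that one
  -- such vertex is fixed.
  obtain ⟨n, hn⟩ : ∃ n, R.ncard = n := ⟨_, rfl⟩
  induction n generalizing K R α with
  | zero =>
    rw [Set.ncard_eq_zero hRfin] at hn
    simp [hn]
  | succ n ih =>
    have hfix : ∀ v ∈ R, ∀ f ∈ K, S.adj f v → ∀ β, S.Aut β → (∀ u ∈ K, β u = u) → β v = v →
        ∀ w ∈ R, β w = w := by
      intro v hv f hf hfv β hβ hβK hβv w hw
      by_cases hwv : w = v
      · rw [hwv, hβv]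
      refine ih (K := insert v K) (R := R \ {v}) (hRfin.sdiff) (hK.cons hf hfv) ?_ ?_ hβ ?_ ?_
        w ⟨hw, hwv⟩
      · rintro u ⟨hu, _⟩ z huz
        by_cases hzv : z = v
        · exact Or.inr (Or.inl hzv)
        · exact (hR u hu z huz).imp (fun h => ⟨h, hzv⟩) Or.inr
      · rw [Set.disjoint_left]
        rintro z (rfl | hz) ⟨hzR, hzv⟩
        · exact hzv rfl
        · exact Set.disjoint_left.1 hKR hz hzR
      · rintro u (rfl | hu)
        exacts [hβv, hβK u hu]
      · rw [Set.ncard_sdiff_singleton_of_mem hv, hn]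
        rfl
    have hex : ∃ v ∈ R, ∃ f ∈ K, S.adj f v := by
      obtain ⟨f, hf⟩ := hK.nonempty
      have hRne : R.Nonempty := Set.nonempty_of_ncard_ne_zero (by omega)
      obtain ⟨w, hw⟩ := hRne
      by_contra! hcon
      have key : ∀ z, Relation.ReflTransGen S.adj w z → z ∈ R := by
        intro z hz
        induction hz with
        | refl => exact hw
        | tail _ hbc ihb =>
          exact (hR _ ihb _ hbc).resolve_right fun hc => hcon _ ihb _ hc (adj_symm hbc)
      exact Set.disjoint_left.1 hKR hf (key f (connected_adj w f))
    obtain ⟨v, hv, f, hf, hfv⟩ := hex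
    refine hfix v hv f hf hfv α hα hαK ?_
    by_contra hαv
    rcases hfv with hfv | hvf
    · refine h.rev.not_moved_of_in (S := S.rev) (K := K) (R := R) (by rwa [rev_adj])
        (by rwa [rev_adj]) ?_ hv hf hfv (α := α) (fun x y => hα y x) hαK hαv
      rw [rev_adj]
      exact fun v hv f hf hfv β hβ => hfix v hv f hf hfv β (rev_aut hβ)
    · exact h.not_moved_of_in hK hR hfix hv hf hvf hα hαK hαv

variable (S) in
/-- The vertices with respect to which `a` and `a'` differ, including `a` and `a'`. -/
def difference (a a' : V) : Set V :=
  {u | u = a ∨ u = a' ∨ ¬ ((S.r u a ↔ S.r u a') ∧ (S.r a u ↔ S.r a' u))}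

theorem finite_difference (a a' : V) : (S.difference a a').Finite := by
  refine (((finite_adj (S := S) a).union (finite_adj (S := S) a')).insert a |>.insert a').subset ?_
  rintro u (rfl | rfl | hu)
  · exact Or.inr (Or.inl rfl)
  · exact Or.inl rfl
  · by_contra hcon
    refine hu ?_
    simp only [Set.mem_insert_iff, Set.mem_union, Set.mem_ofPred_eq, adj] at hcon
    tauto

variable (S) in
/-- The component of `x` after deletion of the vertices with respect to which `a` and `a'`
differ. -/
def side (x a a' : V) : Set V :=
  {u | Relation.ReflTransGen (fun u v => S.adj u v ∧ v ∉ S.difference a a') x u}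

theorem difference_comm (a a' : V) : S.difference a a' = S.difference a' a := by
  ext u
  simp only [difference, Set.mem_ofPred_eq]
  tauto

section side

variable {x a a' : V} (ha : S.r a x) (ha' : S.r a' x)

theorem self_mem_side : x ∈ S.side x a a' := .refl

theorem mem_side_of_adj {u v : V} (hu : u ∈ S.side x a a') (huv : S.adj u v)
    (hv : v ∉ S.difference a a') : v ∈ S.side x a a' := Relation.ReflTransGen.tail hu ⟨huv, hv⟩

include ha ha'

theorem notMem_difference : x ∉ S.difference a a' := by
  rintro (rfl | rfl | h)
  · exact irrefl _ ha
  · exact irrefl _ ha'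
  · exact h ⟨iff_of_false (S.asymm _ _ ha) (S.asymm _ _ ha'), iff_of_true ha ha'⟩

theorem side_disjoint_difference {u : V} (hu : u ∈ S.side x a a') : u ∉ S.difference a a' := by
  rcases Relation.ReflTransGen.cases_tail hu with rfl | ⟨_, _, h⟩
  · exact notMem_difference ha ha'
  · exact h.2

/-- No vertex of the side distinguishes a from a', so they can be swapped over any finite connected
part of it containing x. -/
theorem exists_swap_of_subset_side {P : Set V} (hP : P.Finite) (hPF : P ⊆ S.side x a a') :
    ∃ K, FinConn S.adj K ∧ x ∈ K ∧ K ⊆ S.side x a a' ∧ P ⊆ K ∧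
      ∃ α, S.Aut α ∧ (∀ u ∈ K, α u = u) ∧ α a = a' ∧ α a' = a := by
  have hstep : ∀ y, Relation.ReflTransGen (fun u v => S.adj u v ∧ v ∉ S.difference a a') x y →
      Relation.ReflTransGen (fun u v => S.adj u v ∧ v ∈ S.side x a a') x y := by
    intro y hy
    induction hy with
    | refl => exact .refl
    | tail hxb hbc ih => exact ih.tail ⟨hbc.1, hxb.tail hbc⟩
  obtain ⟨K, hK, hxK, hKF, hPK⟩ := (FinConn.single (adj := S.adj) x).extend_finite
    (T := S.side x a a') (by simpa using self_mem_side) (x := x) rfl hP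
    fun y hy => hstep y (hPF hy)
  have hnot : ∀ u ∈ K, u ∉ S.difference a a' := fun u hu =>
    side_disjoint_difference ha ha' (hKF hu)
  obtain ⟨α, hα, hαK, h1, h2⟩ := exists_swap hK (v := a) (w := a')
    (fun h => hnot a h (Or.inl rfl)) (fun h => hnot a' h (Or.inr (Or.inl rfl)))
    (fun u hu => by
      by_contra hcon
      exact hnot u hu (Or.inr (Or.inr hcon)))
    (u := x) (hxK rfl) (Or.inr ha)
  exact ⟨K, hK, hxK rfl, hKF, hPK, α, hα, hαK, h1, h2⟩

end side

/-- The edges leaving a side all belong to the same class. -/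
theorem Splits.class_of_leaving (h : S.Splits) {x a a' : V} (ha : S.r a x) (ha' : S.r a' x)
    (hne : a ≠ a') {f u : V} (hf : f ∈ S.side x a a') (hu : u ∉ S.side x a a')
    (hfu : S.adj f u) : S.e (S.ic x) f u := by
  -- Up to exchanging a and a', these are the ways for u to be in the difference set. A swap of a
  -- and a' fixing f sends u to another neighbour of f; every configuration outside the class of x's
  -- in-edges then violates `in_ne` or `oc_ne_of_branch`.
  have key : ∀ {a a'}, S.r a x → S.r a' x → a ≠ a' → f ∈ S.side x a a' → u ∉ S.side x a a' →
      (u = a ∨ (S.r u a ∧ ¬ S.r u a') ∨ (S.r a u ∧ ¬ S.r a' u)) → S.e (S.ic x) f u := by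
    intro a a' ha ha' hne hf hu hcase
    obtain ⟨K, -, -, -, hfK, α, hα, hαK, h1, h2⟩ := exists_swap_of_subset_side ha ha'
      (P := {f}) (Set.finite_singleton f) (by simpa using hf)
    have hαf : α f = f := hαK f (hfK rfl)
    have hα' : ∀ {z}, (S.r (α z) f ↔ S.r z f) ∧ (S.r f (α z) ↔ S.r f z) := by
      intro z
      rw [← hα z f, ← hα f z, hαf]
      exact ⟨Iff.rfl, Iff.rfl⟩
    have hic : S.ic a ≠ S.ic a' := h.in_ne ha ha' hne
    have e1 := S.edge _ _ ha
    have e2 := S.edge _ _ ha'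
    rcases hcase with rfl | ⟨hua, hua'⟩ | ⟨hau, hau'⟩
    · rcases hfu with hfu | huf
      · have := hα'.2.2 hfu
        rw [h1] at this
        exact absurd ((S.edge _ _ hfu).symm.trans (S.edge _ _ this)) hic
      · exact Or.inr ⟨huf, e1⟩
    · have hu' : S.r (α u) a' := by
        rw [← h1, hα]
        exact hua
      have hmove : u ≠ α u := fun h => hua' (h ▸ hu')
      rcases hfu with hfu | huf
      · exact absurd (e1.trans e2.symm)
          (h.oc_ne_of_branch hfu (hα'.2.2 hfu) hmove hua hu')
      · have := (S.edge _ _ huf).trans (S.edge _ _ (hα'.1.2 huf)).symm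
        rw [S.edge _ _ hua, S.edge _ _ hu'] at this
        exact absurd this hic
    · have hu' : S.r a' (α u) := by
        rw [← h1, hα]
        exact hau
      have hmove : u ≠ α u := fun h => hau' (h ▸ hu')
      have hicu : S.ic u = S.ic x := (S.edge _ _ hau).symm.trans e1
      have hicu' : S.ic (α u) = S.ic x := (S.edge _ _ hu').symm.trans e2
      rcases hfu with hfu | huf
      · exact Or.inl ⟨hfu, (S.edge _ _ hfu).trans hicu⟩
      · exact absurd (hicu.trans hicu'.symm) (h.in_ne huf (hα'.1.2 huf) hmove)
  have hud : u ∈ S.difference a a' := by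
    by_contra hcon
    exact hu (mem_side_of_adj hf hfu hcon)
  have hcomm : S.side x a a' = S.side x a' a := by
    unfold side
    rw [difference_comm]
  have k1 := key ha ha' hne hf hu
  have k2 := key ha' ha hne.symm (hcomm ▸ hf) (hcomm ▸ hu)
  simp only [difference, Set.mem_ofPred_eq] at hud
  by_contra hcon
  have k1' := fun h => hcon (k1 h)
  have k2' := fun h => hcon (k2 h)
  tauto

/-- If the complement were finite, finitely many vertices of the side would attach to it. A swap of
a and a' fixing these would, by rigidity, fix the complement, which contains a. -/
theorem Splits.infinite_compl_side (h : S.Splits) {x a a' : V} (ha : S.r a x) (ha' : S.r a' x)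
    (hne : a ≠ a') : (S.side x a a')ᶜ.Infinite := by
  intro hfin
  have hP : {f | f ∈ S.side x a a' ∧ ∃ u ∈ (S.side x a a')ᶜ, S.adj u f}.Finite := by
    refine (hfin.biUnion fun u _ => finite_adj (S := S) u).subset ?_
    rintro f ⟨_, u, hu, huf⟩
    exact Set.mem_iUnion₂.2 ⟨u, hu, huf⟩
  obtain ⟨K, hK, -, hKF, hPK, α, hα, hαK, h1, -⟩ := exists_swap_of_subset_side ha ha' hP
    fun f hf => hf.1
  refine hne (Eq.symm (h1.symm.trans (h.eq_of_fixes hfin hK ?_ ?_ hα hαK a ?_)))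
  · intro u hu v huv
    by_cases hv : v ∈ S.side x a a'
    · exact Or.inr (hPK ⟨hv, u, hu, huv⟩)
    · exact Or.inl hv
  · exact disjoint_compl_right.mono_left hKF
  · exact fun hmem => side_disjoint_difference ha ha' hmem (Or.inl rfl)

theorem Splits.nontrivial_ends_of_infinite_side (h : S.Splits) {x a a' : V} (ha : S.r a x)
    (ha' : S.r a' x) (hne : a ≠ a') (hinf : (S.side x a a').Infinite) :
    Nontrivial (Quotient (raySetoid S.graph)) := by
  refine nontrivial_ends_of_infinite S.conn (fun u => finite_adj (S := S) u)
    (finite_difference (S := S) a a') hinf (h.infinite_compl_side ha ha' hne) fun u hu v huv => ?_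
  by_cases hv : v ∈ S.difference a a'
  · exact Or.inr hv
  · exact Or.inl (mem_side_of_adj hu huv hv)

variable (S) in
/-- The vertices that can be reached from `v` without using edges of the class `B`. -/
def branch (B : S.C) (v : V) : Set V :=
  {u | Relation.ReflTransGen (fun u v => S.adj u v ∧ ¬ S.e B u v) v u}

theorem rev_branch (B : S.C) (v : V) : S.rev.branch B v = S.branch B v := by
  have : (fun u v => S.rev.adj u v ∧ ¬ S.rev.e B u v) = fun u v => S.adj u v ∧ ¬ S.e B u v := by
    ext u v
    exact and_congr or_comm (not_congr rev_e)
  unfold branch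
  rw [this]

theorem Splits.branch_subset_side (h : S.Splits) {x a a' : V} (ha : S.r a x) (ha' : S.r a' x)
    (hne : a ≠ a') : S.branch (S.ic x) x ⊆ S.side x a a' := by
  intro u hu
  replace hu : Relation.ReflTransGen _ x u := hu
  induction hu with
  | refl => exact self_mem_side
  | tail _ hbc ih =>
    by_contra hcon
    exact hbc.2 (h.class_of_leaving ha ha' hne ih hcon hbc.1)

/-- With one end all sides are finite, in both orientations, and this makes V finite. -/
theorem Splits.nontrivial_ends (h : S.Splits) : Nontrivial (Quotient (raySetoid S.graph)) := by
  by_contra hcon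
  have hfin : ∀ {x a a'}, S.r a x → S.r a' x → a ≠ a' → (S.side x a a').Finite :=
    fun ha ha' hne => Set.not_infinite.1 fun hinf =>
      hcon (h.nontrivial_ends_of_infinite_side ha ha' hne hinf)
  have hfin' : ∀ {x a a'}, S.r x a → S.r x a' → a ≠ a' → (S.rev.side x a a').Finite :=
    fun ha ha' hne => Set.not_infinite.1 fun hinf => hcon (by
      have := h.rev.nontrivial_ends_of_infinite_side ha ha' hne hinf
      rwa [rev_graph] at this)
  have hbr : ∀ v, (S.branch (S.ic v) v).Finite := by
    intro v
    obtain ⟨a, a', hne, ha, ha'⟩ := h.in_two v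
    exact (hfin ha ha' hne).subset (h.branch_subset_side ha ha' hne)
  have hbr' : ∀ v, (S.branch (S.oc v) v).Finite := by
    intro v
    obtain ⟨a, a', hne, ha, ha'⟩ := h.out_two v
    have := h.rev.branch_subset_side ha ha' hne
    exact (hfin' ha ha' hne).subset ((rev_branch (S := S) (S.oc v) v).ge.trans this)
  obtain ⟨x⟩ := S.conn.nonempty
  obtain ⟨a, a', hne, ha, ha'⟩ := h.in_two x
  -- Only edges of class ic x leave the side of x, so the walks of class oc x from x stay inside it.
  have hclass : {v | S.ic v = S.oc x ∨ S.oc v = S.oc x}.Finite := by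
    refine (hfin ha ha' hne).subset fun v hv => ?_
    induction S.chain _ x v (Or.inr rfl) hv with
    | refl => exact self_mem_side
    | @tail b c _ hbc ih =>
      have hb : S.ic b = S.oc x ∨ S.oc b = S.oc x := by
        rcases hbc with ⟨_, h2⟩ | ⟨h1, h2⟩
        · exact Or.inr h2
        · exact Or.inl ((S.edge _ _ h1).symm.trans h2)
      by_contra hc
      rcases h.class_of_leaving ha ha' hne (ih hb) hc (e_adj hbc) with ⟨h1, h2⟩ | ⟨h1, h2⟩
      · rcases hbc with ⟨_, h3⟩ | ⟨h3, _⟩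
        · exact S.ne x (h2.symm.trans h3)
        · exact S.asymm _ _ h1 h3
      · rcases hbc with ⟨h3, _⟩ | ⟨_, h3⟩
        · exact S.asymm _ _ h1 h3
        · exact S.ne x (h2.symm.trans h3)
  -- Cutting a walk from x at its last edge of class oc x leaves a tail avoiding that class.
  have hall : ∀ v, v ∈ ⋃ w ∈ {w | S.ic w = S.oc x ∨ S.oc w = S.oc x}, S.branch (S.oc x) w := by
    intro v
    simp only [Set.mem_iUnion₂]
    induction connected_adj (S := S) x v with
    | refl => exact ⟨x, Or.inr rfl, .refl⟩
    | @tail b c _ hbc ih =>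
      obtain ⟨w, hw, hwb⟩ := ih
      by_cases he : S.e (S.oc x) b c
      · refine ⟨c, ?_, .refl⟩
        rcases he with ⟨h1, h2⟩ | ⟨_, h2⟩
        · exact Or.inl ((S.edge _ _ h1).symm.trans h2)
        · exact Or.inr h2
      · exact ⟨w, hw, Relation.ReflTransGen.tail hwb ⟨hbc, he⟩⟩
  have hV : (Set.univ : Set V).Finite := by
    refine (hclass.biUnion (t := S.branch (S.oc x)) fun w hw => ?_).subset fun v _ => hall v
    rcases hw with hw | hw
    · rw [← hw]
      exact hbr w
    · rw [← hw]
      exact hbr' w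
  exact h.infinite_compl_side ha ha' hne (hV.subset (Set.subset_univ _))

/-! ### The case distinction -/

theorem IsCycleBlowup.of_rev (h : S.rev.IsCycleBlowup) : S.IsCycleBlowup := by
  obtain ⟨m, n, hm, hn, φ, hφ⟩ := h
  refine ⟨m, n, hm, hn, φ.trans ((Equiv.neg (ZMod m)).prodCongr (Equiv.refl _)), fun u v => ?_⟩
  have : S.r u v ↔ (φ u).1 = (φ v).1 + 1 := hφ v u
  rw [this]
  simp only [Equiv.trans_apply, Equiv.prodCongr_apply, Prod.map_fst, Equiv.neg_apply]
  constructor <;> intro h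
  · rw [h]
    ring
  · linear_combination h

theorem nontrivial_ends_or_isCycleBlowup_of_classed (S : ClassedDigraph V) :
    Nontrivial (Quotient (raySetoid S.graph)) ∨ S.IsCycleBlowup := by
  have hrev : (Nontrivial (Quotient (raySetoid S.rev.graph)) ∨ S.rev.IsCycleBlowup) →
      Nontrivial (Quotient (raySetoid S.graph)) ∨ S.IsCycleBlowup := by
    rw [rev_graph]
    exact Or.imp_right IsCycleBlowup.of_rev
  have htwo : ∀ S : ClassedDigraph V, (¬ ∀ x y b, S.r x b → S.r y b → x = y) →
      ∀ w, ∃ x x', x ≠ x' ∧ S.r x w ∧ S.r x' w := by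
    intro S h w
    push Not at h
    obtain ⟨x, y, b, hx, hy, hne⟩ := h
    obtain ⟨α, hα, rfl⟩ := S.vt b w
    exact ⟨α x, α y, fun h => hne (α.injective h), (hα _ _).2 hx, (hα _ _).2 hy⟩
  by_cases h1 : ∀ x y b, S.r x b → S.r y b → x = y
  · exact nontrivial_ends_or_isCycleBlowup_of_inDegree_one h1
  by_cases h2 : ∀ x y b, S.r b x → S.r b y → x = y
  · exact hrev (nontrivial_ends_or_isCycleBlowup_of_inDegree_one (S := S.rev) h2)
  have hl := htwo S h1
  have hk := htwo S.rev h2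
  by_cases h3 : ∀ a y y', S.r a y → S.r a y' → y ≠ y' → S.oc y ≠ S.oc y'
  · by_cases h4 : ∀ a y y', S.r y a → S.r y' a → y ≠ y' → S.ic y ≠ S.ic y'
    · exact Or.inl (Splits.nontrivial_ends ⟨hk, hl, h3 _ _ _, h4 _ _ _⟩)
    · push Not at h4
      obtain ⟨a, y, y', hy, hy', hne, heq⟩ := h4
      exact hrev (nontrivial_ends_or_isCycleBlowup_of_oc_eq (S := S.rev) hl hk hy hy' hne heq)
  · push Not at h3
    obtain ⟨a, y, y', hy, hy', hne, heq⟩ := h3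
    exact nontrivial_ends_or_isCycleBlowup_of_oc_eq hk hl hy hy' hne heq

end ClassedDigraph

/-! ### Reachability classes and swaps from C-homogeneity -/

namespace Digraph

variable {V : Type u} (D : Digraph V)

theorem toSimpleGraphInclusive_eq_relGraph (hasymm : D.IsAsymmetric) :
    D.toSimpleGraphInclusive = relGraph D.Adj fun x hx => hasymm x x hx hx := by
  ext u v
  refine (SimpleGraph.fromRel_adj _ _ _).trans ⟨And.right, fun h => ⟨?_, h⟩⟩
  rintro rfl
  exact h.elim (fun h => hasymm _ _ h h) fun h => hasymm _ _ h h

theorem isConnected_inducedOn (hasymm : D.IsAsymmetric) {F : Set V}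
    (hF : FinConn (fun u v => D.Adj u v ∨ D.Adj v u) F) : (D.inducedOn F).IsConnected := by
  have h : ∃ b ∈ F, ∀ u ∈ F, Relation.ReflTransGen
      (fun u v => (D.Adj u v ∨ D.Adj v u) ∧ u ∈ F ∧ v ∈ F) b u := by
    induction hF with
    | single v =>
      refine ⟨v, rfl, fun u hu => ?_⟩
      rw [Set.mem_singleton_iff.1 hu]
    | @cons F u v _ hu huv ih =>
      obtain ⟨b, hb, h⟩ := ih
      have h' : ∀ w ∈ F, Relation.ReflTransGen (fun x y => (D.Adj x y ∨ D.Adj y x) ∧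
          x ∈ insert v F ∧ y ∈ insert v F) b w := fun w hw =>
        Relation.ReflTransGen.mono (fun _ _ h => ⟨h.1, Or.inr h.2.1, Or.inr h.2.2⟩) _ _ (h w hw)
      refine ⟨b, Or.inr hb, ?_⟩
      rintro w (rfl | hw)
      · exact (h' u hu).tail ⟨huv, Or.inr hu, Or.inl rfl⟩
      · exact h' w hw
  obtain ⟨b, hb, h⟩ := h
  refine (SimpleGraph.connected_iff_exists_forall_reachable _).2 ⟨⟨b, hb⟩, ?_⟩
  have key : ∀ w, Relation.ReflTransGen
      (fun u v => (D.Adj u v ∨ D.Adj v u) ∧ u ∈ F ∧ v ∈ F) b w →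
      ∀ hw : w ∈ F, (D.inducedOn F).toSimpleGraphInclusive.Reachable ⟨b, hb⟩ ⟨w, hw⟩ := by
    intro w hw
    induction hw with
    | refl => exact fun _ => .refl _
    | @tail x y _ hxy ih =>
      intro hy
      refine (ih hxy.2.1).trans (SimpleGraph.Adj.reachable ?_)
      refine (SimpleGraph.fromRel_adj _ _ _).2 ⟨?_, hxy.1⟩
      intro heq
      have heq : x = y := congrArg Subtype.val heq
      subst heq
      exact hxy.1.elim (fun h => hasymm _ _ h h) fun h => hasymm _ _ h h
  exact fun w => key w (h w w.2) w.2

/-- The tail of an edge, marked `inl`, and its head, marked `inr`, are linked. -/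
def Linked (p q : V ⊕ V) : Prop := ∃ x y, D.Adj x y ∧ p = Sum.inl x ∧ q = Sum.inr y

/-- The common class of the edges out of `x`. -/
def outClass (x : V) : Quot D.Linked := Quot.mk _ (Sum.inl x)

/-- The common class of the edges into `x`. -/
def inClass (x : V) : Quot D.Linked := Quot.mk _ (Sum.inr x)

theorem reflTransGen_of_eqvGen {p q : V ⊕ V} (h : Relation.EqvGen D.Linked p q)
    {B : Quot D.Linked} (hp : Quot.mk _ p = B) :
    Relation.ReflTransGen (fun a b => (D.Adj a b ∧ D.outClass a = B) ∨
      (D.Adj b a ∧ D.outClass b = B)) (Sum.elim id id p) (Sum.elim id id q) := by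
  induction h with
  | rel p q h =>
    obtain ⟨x, y, hxy, rfl, rfl⟩ := h
    exact .single (Or.inl ⟨hxy, hp⟩)
  | refl p => exact .refl
  | symm p q h ih =>
    exact Relation.reflTransGen_swap.1 (Relation.ReflTransGen.mono (fun _ _ h => Or.symm h) _ _
      (ih ((Quot.eqvGen_sound h).trans hp)))
  | trans p q s h1 _ ih1 ih2 => exact (ih1 hp).trans (ih2 ((Quot.eqvGen_sound h1).symm.trans hp))

/-- Some alternating walk that traverses `e` ends with the step from `a` to `b`. -/
def EndsWalk (e : V × V) (a b : V) : Prop :=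
  ∃ (n : ℕ) (c : ℕ → V), D.IsAlternatingWalk (n + 1) c ∧ LiesOnWalk e (n + 1) c ∧
    c n = a ∧ c (n + 1) = b

variable {D}

theorem EndsWalk.step {e : V × V} {a b c : V} (h : D.EndsWalk e a b)
    (hbc : D.Adj b c ∨ D.Adj c b) (hiff : D.Adj b a ↔ D.Adj b c) : D.EndsWalk e b c := by
  obtain ⟨n, x, ⟨h1, h2⟩, ⟨i, hi, h3⟩, rfl, rfl⟩ := h
  refine ⟨n + 1, fun j => if j ≤ n + 1 then x j else c, ⟨fun j hj => ?_, fun j hj => ?_⟩,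
    ⟨i, by omega, ?_⟩, by simp, by simp⟩
  · rcases Nat.lt_or_ge j (n + 1) with h | h
    · simpa [show j ≤ n + 1 by omega, show j ≤ n by omega] using h1 j h
    · obtain rfl : j = n + 1 := by omega
      simpa using hbc
  · rcases Nat.lt_or_ge (j + 1) (n + 1) with h | h
    · simpa [show j ≤ n + 1 by omega, show j ≤ n by omega, show j + 2 ≤ n + 1 by omega]
        using h2 j h
    · obtain rfl : j = n := by omega
      simpa using hiff
  · simpa [show i ≤ n + 1 by omega, show i ≤ n by omega] using h3

theorem EndsWalk.back {e : V × V} {a b : V} (h : D.EndsWalk e a b)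
    (hab : D.Adj a b ∨ D.Adj b a) : D.EndsWalk e b a := h.step hab.symm Iff.rfl

/-- Being the last edge of an alternating walk through (x, y), traversed forwards, spreads to all
edges with the same tail or the same head, since walks may turn back. It is therefore an invariant
of `Linked` and descends to the quotient. -/
theorem EndsWalk.of_inClass_eq_outClass (hasymm : D.IsAsymmetric) {x y w : V}
    (hxy : D.Adj x y) (hwx : D.Adj w x) (h : D.inClass x = D.outClass x) :
    D.EndsWalk (x, y) w x := by
  have htail : ∀ {u v v'}, D.Adj u v → D.Adj u v' → D.EndsWalk (x, y) u v →
      D.EndsWalk (x, y) u v' := fun h1 h2 h3 =>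
    (h3.back (Or.inl h1)).step (Or.inl h2) (iff_of_true h1 h2)
  have hhead : ∀ {u u' v}, D.Adj u v → D.Adj u' v → D.EndsWalk (x, y) u v →
      D.EndsWalk (x, y) u' v := fun h1 h2 h3 =>
    (h3.step (Or.inr h2) (iff_of_false (hasymm _ _ h1) (hasymm _ _ h2))).back (Or.inr h2)
  let good : V ⊕ V → Prop := Sum.elim (fun u => ∀ v, D.Adj u v → D.EndsWalk (x, y) u v)
    fun v => ∀ u, D.Adj u v → D.EndsWalk (x, y) u v
  have hgood : ∀ p q, D.Linked p q → good p = good q := by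
    rintro _ _ ⟨u, v, huv, rfl, rfl⟩
    exact propext ⟨fun h u' hu' => hhead huv hu' (h v huv), fun h v' hv' =>
      htail huv hv' (h u huv)⟩
  have hbase : D.EndsWalk (x, y) x y :=
    ⟨0, fun i => if i = 0 then x else y, ⟨fun i hi => by
      obtain rfl : i = 0 := by omega
      simpa using Or.inl hxy, fun i hi => absurd hi (by omega)⟩, ⟨0, one_pos, by simp⟩, by simp,
      by simp⟩
  have h0 : good (Sum.inl x) := fun v hv => htail hxy hv hbase
  have h1 : good (Sum.inr x) := by
    have := congrArg (Quot.lift good hgood) h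
    exact this.mpr h0
  exact h1 w hwx

theorem EndsWalk.reachable {e : V × V} {a b : V} (h : D.EndsWalk e a b) (he : D.Adj e.1 e.2)
    (hab : D.Adj a b) : D.Reachable e (a, b) := by
  obtain ⟨n, c, h1, h2, h3, h4⟩ := h
  exact ⟨he, hab, n + 1, c, h1, h2, n, by omega, Or.inl ⟨h3, h4⟩⟩

/-- Otherwise (w, x) is reachable from (x, y), so x has both a predecessor and a successor in the
reachability digraph and fits in neither part. -/
theorem inClass_ne_outClass (hasymm : D.IsAsymmetric) (hbip : D.HasBipartiteReachability)
    {x y w : V} (hxy : D.Adj x y) (hwx : D.Adj w x) : D.inClass x ≠ D.outClass x := by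
  intro h
  have h1 : D.Reachable (x, y) (w, x) :=
    (EndsWalk.of_inClass_eq_outClass hasymm hxy hwx h).reachable hxy hwx
  have h2 : D.Reachable (x, y) (x, y) := by
    refine ⟨hxy, hxy, 1, fun i => if i = 0 then x else y, ⟨fun i hi => ?_, fun i hi =>
      absurd hi (by omega)⟩, ⟨0, one_pos, by simp⟩, 0, one_pos, by simp⟩
    obtain rfl : i = 0 := by omega
    simpa using Or.inl hxy
  obtain ⟨X, Y, hXY, -, -, hX, hY⟩ := hbip.2 (x, y) hxy
  let x' : D.reachabilityVerts (x, y) := ⟨x, _, h2, Or.inl rfl⟩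
  let y' : D.reachabilityVerts (x, y) := ⟨y, _, h2, Or.inr rfl⟩
  let w' : D.reachabilityVerts (x, y) := ⟨w, _, h1, Or.inl rfl⟩
  have hmem : x' ∈ X ∪ Y := by
    have hu : X ∪ Y = Set.univ := hXY.sup_eq_top
    rw [hu]
    trivial
  rcases hmem with hm | hm
  · have : w' ∈ (D.reachabilityDigraph (x, y)).inNbhd x' := h1
    rw [hX _ hm] at this
    exact this
  · have : y' ∈ (D.reachabilityDigraph (x, y)).outNbhd x' := h2
    rw [hY _ hm] at this
    exact this

theorem exists_aut_apply_eq (hasymm : D.IsAsymmetric) (hhom : D.IsCHomogeneous) (x y : V) :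
    ∃ α : Equiv.Perm V, (∀ x y, D.Adj (α x) (α y) ↔ D.Adj x y) ∧ α x = y := by
  have hempty : ∀ z, ∀ a b : ({z} : Set V), ¬ D.Adj a b := by
    rintro z ⟨_, rfl⟩ ⟨_, rfl⟩ h
    exact hasymm _ _ h h
  let φ : DiIso (D.inducedOn {x}) (D.inducedOn {y}) :=
    ⟨Equiv.ofUnique _ _, iff_of_false (hempty y _ _) (hempty x _ _)⟩
  obtain ⟨α, hα⟩ := hhom {x} {y} (Set.finite_singleton x) (Set.finite_singleton y)
    (D.isConnected_inducedOn hasymm (.single x)) (D.isConnected_inducedOn hasymm (.single y)) φ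
  exact ⟨α.toEquiv, fun a b => α.map_rel_iff, (hα ⟨x, rfl⟩).trans (φ ⟨x, rfl⟩).2⟩

/-- The transposition of v and w is an automorphism of the connected subdigraph induced on F ∪ {v,
w}, so it extends. -/
theorem exists_aut_swap (hasymm : D.IsAsymmetric) (hhom : D.IsCHomogeneous) {F : Set V}
    (hF : FinConn (fun u v => D.Adj u v ∨ D.Adj v u) F) {v w : V} (hv : v ∉ F) (hw : w ∉ F)
    (ht : ∀ u ∈ F, (D.Adj u v ↔ D.Adj u w) ∧ (D.Adj v u ↔ D.Adj w u))
    (hvw : ¬ (D.Adj v w ∨ D.Adj w v)) (hadj : ∃ u ∈ F, D.Adj u v ∨ D.Adj v u) :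
    ∃ α : Equiv.Perm V, (∀ x y, D.Adj (α x) (α y) ↔ D.Adj x y) ∧ (∀ u ∈ F, α u = u) ∧
      α v = w ∧ α w = v := by
  classical
  obtain ⟨u, hu, huv⟩ := hadj
  have hconn : FinConn (fun u v => D.Adj u v ∨ D.Adj v u) (insert w (insert v F)) :=
    (hF.cons hu huv).cons (Or.inr hu) (by rwa [← (ht u hu).1, ← (ht u hu).2])
  have hfixF : ∀ u ∈ F, Equiv.swap v w u = u := fun u hu =>
    Equiv.swap_apply_of_ne_of_ne (fun h => hv (h ▸ hu)) fun h => hw (h ▸ hu)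
  have hmem : ∀ a, a ∈ insert w (insert v F) ↔ Equiv.swap v w a ∈ insert w (insert v F) := by
    have h1 : ∀ a ∈ insert w (insert v F), Equiv.swap v w a ∈ insert w (insert v F) := by
      rintro a (rfl | rfl | ha)
      · simp
      · simp
      · rw [hfixF a ha]
        exact Or.inr (Or.inr ha)
    exact fun a => ⟨h1 a, fun h => by simpa using h1 _ h⟩
  have hrel : ∀ a ∈ insert w (insert v F), ∀ b ∈ insert w (insert v F),
      (D.Adj (Equiv.swap v w a) (Equiv.swap v w b) ↔ D.Adj a b) := by
    have hloop : ∀ z, ¬ D.Adj z z := fun z h => hasymm z z h h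
    rintro a (rfl | rfl | ha) b (rfl | rfl | hb)
    · simp [hloop]
    · simp only [Equiv.swap_apply_left, Equiv.swap_apply_right]
      tauto
    · simp only [Equiv.swap_apply_right, hfixF b hb]
      exact (ht b hb).2
    · simp only [Equiv.swap_apply_left, Equiv.swap_apply_right]
      tauto
    · simp [hloop]
    · simp only [Equiv.swap_apply_left, hfixF b hb]
      exact (ht b hb).2.symm
    · simp only [Equiv.swap_apply_right, hfixF a ha]
      exact (ht a ha).1
    · simp only [Equiv.swap_apply_left, hfixF a ha]
      exact (ht a ha).1.symm
    · rw [hfixF a ha, hfixF b hb]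
  let φ : DiIso (D.inducedOn (insert w (insert v F))) (D.inducedOn (insert w (insert v F))) :=
    ⟨(Equiv.swap v w).subtypeEquiv hmem, fun {a b} => hrel a a.2 b b.2⟩
  have hc := D.isConnected_inducedOn hasymm hconn
  obtain ⟨α, hα⟩ := hhom _ _ hconn.finite hconn.finite hc hc φ
  have hα' : ∀ a ∈ insert w (insert v F), α a = Equiv.swap v w a := fun a ha => hα ⟨a, ha⟩
  refine ⟨α.toEquiv, fun a b => α.map_rel_iff, fun u hu => ?_, ?_, ?_⟩
  · exact (hα' u (Or.inr (Or.inr hu))).trans (hfixF u hu)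
  · exact (hα' v (Or.inr (Or.inl rfl))).trans (Equiv.swap_apply_left _ _)
  · exact (hα' w (Or.inl rfl)).trans (Equiv.swap_apply_right _ _)

/-- A triangle is either directed or transitive, and the source of a transitive one has two adjacent
out-neighbours. -/
theorem not_adj_of_adj_adj (htri : ¬ D.HasDirectedTriangle)
    (hout : ∀ x, D.IsIndependent (D.outNbhd x))
    (x y z : V) (hxy : D.Adj x y ∨ D.Adj y x) (hyz : D.Adj y z ∨ D.Adj z y) :
    ¬ (D.Adj x z ∨ D.Adj z x) := by
  have htri' : ∀ {x y z}, D.Adj x y → D.Adj y z → ¬ D.Adj z x := fun h1 h2 h3 =>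
    htri ⟨_, _, _, h1, h2, h3⟩
  have hout' : ∀ {x y z}, D.Adj x y → D.Adj x z → ¬ D.Adj y z := fun h1 h2 => hout _ _ h1 _ h2
  rintro (hxz | hzx) <;> rcases hxy with hxy | hyx <;> rcases hyz with hyz | hzy
  · exact hout' hxy hxz hyz
  · exact hout' hxz hxy hzy
  · exact hout' hyx hyz hxz
  · exact htri' hyx hxz hzy
  · exact htri' hxy hyz hzx
  · exact hout' hzx hzy hxy
  · exact hout' hyz hyx hzx
  · exact hout' hzy hzx hyx

end Digraph

/-- The digraph together with the classes of its edges under reachability. -/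
def Digraph.classed {V : Type u} [Nonempty V] (D : Digraph V)
    (hasymm : D.IsAsymmetric) (hlf : D.IsLocallyFinite) (hconn : D.IsConnected)
    (hhom : D.IsCHomogeneous) (htri : ¬ D.HasDirectedTriangle)
    (hout : ∀ x, D.IsIndependent (D.outNbhd x))
    (hbip : D.HasBipartiteReachability) : ClassedDigraph V :=
  have hneOut : ∀ x, ∃ y, D.Adj x y := fun x => by
    obtain ⟨⟨⟨u, v⟩, huv⟩, _⟩ := hbip
    obtain ⟨α, hα, rfl⟩ := exists_aut_apply_eq hasymm hhom u x
    exact ⟨α v, (hα _ _).2 huv⟩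
  have hneIn : ∀ x, ∃ y, D.Adj y x := fun x => by
    obtain ⟨⟨⟨u, v⟩, huv⟩, _⟩ := hbip
    obtain ⟨α, hα, rfl⟩ := exists_aut_apply_eq hasymm hhom v x
    exact ⟨α u, (hα _ _).2 huv⟩
  have htri' := not_adj_of_adj_adj htri hout
  { r := D.Adj
    C := Quot D.Linked
    ic := D.inClass
    oc := D.outClass
    asymm := hasymm
    tri := htri'
    finOut := fun x => (hlf x).subset Set.subset_union_left
    finIn := fun x => (hlf x).subset Set.subset_union_right
    neOut := hneOut
    neIn := hneIn
    conn := by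
      rw [← D.toSimpleGraphInclusive_eq_relGraph hasymm]
      exact hconn
    edge := fun x y h => Quot.sound ⟨x, y, h, rfl, rfl⟩
    ne := fun x => by
      obtain ⟨y, hy⟩ := hneOut x
      obtain ⟨w, hw⟩ := hneIn x
      exact inClass_ne_outClass hasymm hbip hy hw
    clmap := fun α hα => ⟨Quot.map (Sum.map α α) (by
      rintro _ _ ⟨x, y, hxy, rfl, rfl⟩
      exact ⟨α x, α y, (hα x y).2 hxy, rfl, rfl⟩), fun _ => rfl, fun _ => rfl⟩
    chain := by
      intro B u v hu hv
      obtain ⟨p, hp, rfl⟩ : ∃ p : V ⊕ V, Quot.mk _ p = B ∧ Sum.elim id id p = u :=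
        hu.elim (fun h => ⟨Sum.inr u, h, rfl⟩) fun h => ⟨Sum.inl u, h, rfl⟩
      obtain ⟨q, hq, rfl⟩ : ∃ p : V ⊕ V, Quot.mk _ p = B ∧ Sum.elim id id p = v :=
        hv.elim (fun h => ⟨Sum.inr v, h, rfl⟩) fun h => ⟨Sum.inl v, h, rfl⟩
      exact D.reflTransGen_of_eqvGen (Quot.eqvGen_exact (hp.trans hq.symm)) hp
    vt := exists_aut_apply_eq hasymm hhom
    sw := by
      intro F hF v w hv hw ht ⟨u, hu, huv⟩
      have huw : D.Adj u w ∨ D.Adj w u := by rwa [← (ht u hu).1, ← (ht u hu).2]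
      exact exists_aut_swap hasymm hhom hF hv hw ht (htri' v u w huv.symm huw) ⟨u, hu, huv⟩ }

theorem lemma4p6 {V : Type*} [Nonempty V] (D : Digraph V)
    (hasymm : D.IsAsymmetric)
    (hlf : D.IsLocallyFinite)
    (hconn : D.IsConnected)
    (hhom : D.IsCHomogeneous)
    (htri : ¬ D.HasDirectedTriangle)
    (hout : ∀ x, D.IsIndependent (D.outNbhd x))
    (hin : ∀ x, D.IsIndependent (D.inNbhd x))
    (hbip : D.HasBipartiteReachability) :
    Nontrivial D.Ends ∨
      ∃ m n : ℕ, 4 ≤ m ∧ 1 ≤ n ∧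
        Nonempty (Digraph.DiIso D
          ((Digraph.directedCycle m).lexProduct (⊥ : Digraph (Fin n)))) := by
  let S := D.classed hasymm hlf hconn hhom htri hout hbip
  have hS : D.toSimpleGraphInclusive = S.graph := D.toSimpleGraphInclusive_eq_relGraph hasymm
  refine (ClassedDigraph.nontrivial_ends_or_isCycleBlowup_of_classed S).imp (fun h => ?_) ?_
  · rw [← hS] at h
    exact h
  · rintro ⟨m, n, hm, hn, φ, hφ⟩
    refine ⟨m, n, hm, hn, ⟨φ, fun {u v} => ?_⟩⟩
    refine Iff.trans ⟨fun h => ?_, Or.inl⟩ (hφ u v).symm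
    exact h.resolve_right fun h' => h'.2
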